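/- Conventions. A continuum is a compact connected Hausdorff space (in particular, every compact connected metric space is one); a subcontinuum is a nonempty compact connected subset. Let $m\ge 2$. A continuum $W$ is $m$-thick if $W\setminus A$ is connected for every $A\subseteq W$ with $|A|<m$, and is not connected for some $A$ with $|A|=m$; the sets $A$ with $|A|=m$ and $W\setminus A$ not connected are the min cuts of $W$. A decomposition of $W$ by a min cut $A$ is a pair of subcontinua $M,N$ with $M\cup N=W$, $M\cap N=A$. A min cut $B$ is between min cuts $A$ and $C$ if there is a decomposition $M,N$ of $W$ by $B$ with $A\subseteq M$, $C\subseteq N$. Min cuts $A_1,\dots,A_k$ are linearly ordered if they are distinct and $A_j$ is between $A_i$ and $A_l$ whenever $i<j<l$. A subset $S\subseteq W$ is between min cuts $A$ and $B$ if for every decomposition $M,N$ of $W$ by $A$ either $B\cup S\subseteq M$ or $B\cup S\subseteq N$, and likewise with $A$ and $B$ exchanged. A finite set $F\subseteq W$ is a wheel if there are $n>3$ and non-singleton subcontinua $M_i$ $(i\in\mathbb Z/n)$ with $\bigcup_i M_i=W$, $\bigcup_{i\ne j}(M_i\cap M_j)=F$, such that $I=\bigcap_i M_i$ satisfies $|I|<m$,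 $M_i\cap M_j=I$ whenever $i-j\ne 0,\pm1$, and the topological frontier of each $M_i$ has exactly $m$ points. An infinite set $F\subseteq W$ is a wheel if every finite subset of $F$ lies in a finite wheel contained in $F$. Let $X$ be a proper CAT(0) space with base point $x_0$. Its boundary $\partial X$ is the set of geodesic rays up to bounded distance, with the visual topology. For $\xi,\eta\in\partial X$ represented by rays $\alpha,\beta$ from $x_0$, let $\angle(\xi,\eta)$ be the limit, as $t\to\infty$, of the Euclidean comparison angle at $x_0$ of $x_0,\alpha(t),\beta(t)$. The Tits metric $d_T$, with values in $[0,\infty]$, is the path metric of the metric $\angle$, and the Tits radius of $A\subseteq\partial X$ is $\operatorname{rad}A=\inf\{\epsilon : A\subseteq B_T(z,\epsilon)\text{ for some }z\in\partial X\}$, where $B_T(z,\epsilon)$ is the $d_T$-ball ($\inf\emptyset=\infty$). Theorem. Let $m\ge2$ and let $A_1,\dots,A_8$ be linearly ordered min cuts of an $m$-thick continuum $W$, no two of which are contained in the same wheel. Then there is a subcontinuum $Q\subseteq W$ between $A_1$ and $A_8$ that is separated by some $A_i$ into continua $Q_1,Q_2$ with $|Q_1\cap Q_2|\ge2$; that is,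 $Q$ meets at least two components of $W\setminus A_i$, and there are subcontinua $Q_1,Q_2$ with $Q=Q_1\cup Q_2$, $|Q_1\cap Q_2|\ge 2$, and a decomposition $M,N$ of $W$ by $A_i$ with $Q_1\subseteq M$, $Q_2\subseteq N$. Moreover, if $X$ is a proper CAT(0) space and $W$ is identified with $\partial X$ by a homeomorphism, then $\operatorname{rad}Q\ge\pi$. -/

import Mathlib

open Set Filter Topology
open scoped NNReal ENNReal

section Continua

variable {W : Type*} [TopologicalSpace W]

/-- A subset of `W` that is a continuum (`W` itself will be a Hausdorff continuum). -/
def IsSubcontinuum (Y : Set W) : Prop :=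
  IsCompact Y ∧ IsConnected Y

/-- `W` is `m`-thick: no set of fewer than `m` points separates it, some set of `m` points does. -/
def IsThick (W : Type*) [TopologicalSpace W] (m : ℕ) : Prop :=
  (∀ A : Set W, A.encard < m → IsPreconnected Aᶜ) ∧
    ∃ A : Set W, A.encard = m ∧ ¬ IsPreconnected Aᶜ

/-- The min cuts of an `m`-thick continuum: separating sets with exactly `m` points. -/
def IsMinCut (m : ℕ) (A : Set W) : Prop :=
  A.encard = m ∧ ¬ IsPreconnected Aᶜ

/-- `A` separates `B`: the set `B` meets at least two components of the complement of `A`. -/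
def Separates (A B : Set W) : Prop :=
  ∃ x ∈ B \ A, ∃ y ∈ B \ A, connectedComponentIn Aᶜ x ≠ connectedComponentIn Aᶜ y

/-- The finite set `A` decomposes `W` into the non-singleton continua `Y i`. -/
def Decomposes {ι : Type*} (A : Set W) (Y : ι → Set W) : Prop :=
  A.Finite ∧ (∀ i, IsSubcontinuum (Y i) ∧ (Y i).Nontrivial) ∧
    ⋃ i, Y i = univ ∧ {x | ∃ i j, i ≠ j ∧ x ∈ Y i ∩ Y j} = A

/-- `W = M ∪ N` with `M`, `N` continua and `M ∩ N = A`. -/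
def IsDecomposition (A M N : Set W) : Prop :=
  IsSubcontinuum M ∧ IsSubcontinuum N ∧ M ∪ N = univ ∧ M ∩ N = A

/-- A finite wheel of an `m`-thick continuum, with its cyclically indexed wheel decomposition
`M i`, `i : ZMod n`, whose center is `⋂ i, M i`. -/
def IsFiniteWheel (m : ℕ) (F : Set W) : Prop :=
  ∃ n : ℕ, 3 < n ∧ ∃ M : ZMod n → Set W,
    Decomposes F M ∧
    (⋂ i, M i).encard < m ∧
    (∀ i j, i ≠ j → i - j ≠ 1 → i - j ≠ -1 → M i ∩ M j = ⋂ k, M k) ∧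
    ∀ i, (frontier (M i)).encard = m

/-- A wheel is a finite wheel, or an infinite set each of whose finite subsets lies in a
finite wheel contained in it. -/
def IsWheel (m : ℕ) (F : Set W) : Prop :=
  IsFiniteWheel m F ∨
    (F.Infinite ∧ ∀ S ⊆ F, S.Finite → ∃ V, S ⊆ V ∧ V ⊆ F ∧ IsFiniteWheel m V)

/-- Betweenness of min cuts: the cut `B` is between the cuts `A` and `C`. -/
def CutBetween (A B C : Set W) : Prop :=
  ∃ M N, IsDecomposition B M N ∧ A ⊆ M ∧ C ⊆ N

/-- The min cuts `A 0, …, A (k - 1)` are distinct and linearly ordered by betweenness, in the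
order of their indices. -/
def LinearlyOrderedCuts {k : ℕ} (A : Fin k → Set W) : Prop :=
  Function.Injective A ∧ ∀ i j l, i < j → j < l → CutBetween (A i) (A j) (A l)

/-- The subset `S` is between the min cuts `A` and `B`: no decomposition by one of the two cuts
has `S` together with the other cut on both sides. -/
def SetBetween (A B S : Set W) : Prop :=
  (∀ M N, IsDecomposition A M N → B ∪ S ⊆ M ∨ B ∪ S ⊆ N) ∧
    (∀ M N, IsDecomposition B M N → A ∪ S ⊆ M ∨ A ∪ S ⊆ N)

/-- The cut `A` separates `Q` into the continua `Q₁` and `Q₂`, which lie on the two sides of a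
decomposition of `W` by `A`. -/
def SeparatesInto (A Q Q₁ Q₂ : Set W) : Prop :=
  Separates A Q ∧ IsSubcontinuum Q₁ ∧ IsSubcontinuum Q₂ ∧ Q₁ ∪ Q₂ = Q ∧
    ∃ M N, IsDecomposition A M N ∧ Q₁ ⊆ M ∧ Q₂ ⊆ N

end Continua

section CATZero

variable {X : Type*} [MetricSpace X]

/-- `γ`, restricted to `[0, dist x y]`, is a geodesic from `x` to `y`. -/
def IsGeodesicFromTo (γ : ℝ → X) (x y : X) : Prop :=
  γ 0 = x ∧ γ (dist x y) = y ∧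
    ∀ s ∈ Icc 0 (dist x y), ∀ t ∈ Icc 0 (dist x y), dist (γ s) (γ t) = |s - t|

/-- CAT(0) spaces: geodesic spaces whose geodesic triangles are not fatter than their Euclidean
comparison triangles. Any two points on different sides of a triangle lie on two sides with a
common vertex `a`, here the images of `γ` and `δ`; `p` and `q` are their comparison points. -/
structure IsCATZero (X : Type*) [MetricSpace X] : Prop where
  exists_geodesic : ∀ x y : X, ∃ γ : ℝ → X, IsGeodesicFromTo γ x y
  comparison : ∀ (a b c : X) (γ δ : ℝ → X), IsGeodesicFromTo γ a b → IsGeodesicFromTo δ a c →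
    ∀ a' b' c' : EuclideanSpace ℝ (Fin 2),
      dist a' b' = dist a b → dist a' c' = dist a c → dist b' c' = dist b c →
      ∀ p ∈ segment ℝ a' b', ∀ q ∈ segment ℝ a' c',
        dist (γ (dist a' p)) (δ (dist a' q)) ≤ dist p q

/-- Geodesic rays `[0, ∞) → X`. -/
def GeodesicRay (X : Type*) [MetricSpace X] : Type _ :=
  {α : ℝ≥0 → X // Isometry α}

/-- Two rays are equivalent if they stay at bounded distance. -/
instance raySetoid (X : Type*) [MetricSpace X] : Setoid (GeodesicRay X) where
  r α β := ∃ C : ℝ, ∀ t, dist (α.1 t) (β.1 t) ≤ C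
  iseqv :=
    { refl := fun α => ⟨0, fun t => by simp⟩
      symm := fun ⟨C, h⟩ => ⟨C, fun t => by rw [dist_comm]; exact h t⟩
      trans := fun ⟨C, h⟩ ⟨D, k⟩ =>
        ⟨C + D, fun t => (dist_triangle _ _ _).trans (add_le_add (h t) (k t))⟩ }

/-- The set of points of the visual boundary of `X`. -/
def VisualBoundary (X : Type*) [MetricSpace X] : Type _ :=
  Quotient (raySetoid X)

open Classical in
/-- The geodesic ray from `x₀` that represents `ξ` (it exists and is unique in a proper CAT(0)
space). -/
noncomputable def rayFrom (x₀ : X) (ξ : VisualBoundary X) : ℝ≥0 → X :=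
  if h : ∃ α : GeodesicRay X, α.1 0 = x₀ ∧ Quotient.mk (raySetoid X) α = ξ
  then h.choose.1 else fun _ => x₀

/-- The visual topology on the boundary, seen from the base point `x₀`, generated by the sets
`U(ξ, n, ε)` of all points whose ray from `x₀` is `ε`-close to that of `ξ` at time `n`. -/
@[reducible] def visualTopology (x₀ : X) : TopologicalSpace (VisualBoundary X) :=
  TopologicalSpace.generateFrom
    {U | ∃ (ξ : VisualBoundary X) (n : ℝ≥0) (ε : ℝ), 0 < ε ∧
      U = {η | dist (rayFrom x₀ ξ n) (rayFrom x₀ η n) < ε}}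

/-- The Euclidean comparison angle at `x` of a triangle with vertices `x`, `y`, `z`. -/
noncomputable def comparisonAngle (x y z : X) : ℝ :=
  Real.arccos ((dist x y ^ 2 + dist x z ^ 2 - dist y z ^ 2) / (2 * dist x y * dist x z))

/-- The angle metric on the boundary, computed from the base point `x₀`; the comparison angles
are monotone in `t` in a CAT(0) space, so that the limit exists. -/
noncomputable def boundaryAngle (x₀ : X) (ξ η : VisualBoundary X) : ℝ :=
  limUnder atTop fun t : ℝ≥0 => comparisonAngle x₀ (rayFrom x₀ ξ t) (rayFrom x₀ η t)

/-- `γ`, restricted to `[0, 1]`, is a path from `ξ` to `η` that is continuous in the angle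
metric. -/
def IsAnglePath (x₀ : X) (γ : ℝ → VisualBoundary X) (ξ η : VisualBoundary X) : Prop :=
  γ 0 = ξ ∧ γ 1 = η ∧ ∀ t ∈ Icc (0 : ℝ) 1,
    Tendsto (fun s => boundaryAngle x₀ (γ s) (γ t)) (𝓝[Icc 0 1] t) (𝓝 0)

/-- The length of a path `[0, 1] → ∂X` in the angle metric: the supremum of the sums over all
finite subdivisions. -/
noncomputable def angleLength (x₀ : X) (γ : ℝ → VisualBoundary X) : ℝ≥0∞ :=
  ⨆ (n : ℕ) (u : {u : ℕ → ℝ // Monotone u ∧ ∀ i, u i ∈ Icc (0 : ℝ) 1}),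
    ∑ i ∈ Finset.range n, ENNReal.ofReal (boundaryAngle x₀ (γ (u.1 i)) (γ (u.1 (i + 1))))

/-- The Tits metric, with values in `[0, ∞]`: the path metric of the angle metric. -/
noncomputable def titsDist (x₀ : X) (ξ η : VisualBoundary X) : ℝ≥0∞ :=
  ⨅ (γ : ℝ → VisualBoundary X) (_ : IsAnglePath x₀ γ ξ η), angleLength x₀ γ

/-- The (extrinsic) Tits radius of a set of boundary points. -/
noncomputable def titsRadius (x₀ : X) (A : Set (VisualBoundary X)) : ℝ≥0∞ :=
  sInf {ε | ∃ z : VisualBoundary X, A ⊆ {a | titsDist x₀ z a < ε}}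

end CATZero

/-! ### Frontiers and sides of min cuts. -/

section Cuts

variable {W : Type*} [TopologicalSpace W] {M' N' A B M N : Set W} {m : ℕ}

/-! Thickness enters as a counting principle: a closed set with nonempty interior and nonempty
complement has at least `m` frontier points, since removing fewer points cannot separate `W`.

The end cuts `A 0` and `A 7` orient decompositions `M i`, `N i` of the cuts strictly between them,
so that `M i` grows and `N i` shrinks with `i` (`exists_nestedCuts`). For `i < j` the complement of
`M i ∪ N j` is an open gap. Its closure is a continuum: otherwise counting frontier points shows
that the region between the cuts falls into exactly two continua, which form a wheel together with
the outer sides (`NestedCuts.isFiniteWheel_of_split`). The closure contains all points of the two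
cuts except a set `D i j` of common points, and counting again gives `2 * |D i j| ≤ m`.

For `i < j < l` the closures of the two consecutive gaps share every point of `A j` outside `D i j ∪
D j l`. If two such points remain, the union of the closures is the required `Q`. If this always
fails, then `|D i j ∪ D j l| ≥ m - 1`, so `D i j ∩ D j l`, which contains `D i l`, has at most one
point, and none if `m` is odd. Applying this to the triples 1, 2, 3 and 3, 4, 5 and then using 1, 3,
5 gives `m - 1 ≤ |D 1 3 ∪ D 3 5| ≤ 2`, and parity leaves only `m = 2`. In that case a point of `D 1
3` or `D 3 5` would produce a wheel through three cuts (`NestedCuts.isFiniteWheel_of_isolated`), so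
both sets are empty, a contradiction.

For the Tits radius, two points shared by `Q₁` and `Q₂` give a circle-valued map on `W` that winds
once around on `Q` and has no logarithm there (`exists_circle_map`). Extend it by Tietze to a
compactification of `X`. If `Q` lay in a Tits ball of radius less than `π` about `z`, the geodesics
from the ray of `z` at a late time to the rays of points of `Q` at that time would stay far from
`x₀`, where the extension does not vanish. They contract the map on `Q` to a constant through
nonvanishing maps, which provides a logarithm (`IsCATZero.hasLog_of_boundaryAngle_le`). -/

theorem IsThick.le_ncard_of_frontier_subset (hW : IsThick W m) {K S : Set W} (hS : S.Finite)
    (hK : IsClosed K) (hKS : frontier K ⊆ S) (hInt : (interior K).Nonempty)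
    (hcompl : Kᶜ.Nonempty) : m ≤ S.ncard := by
  refine le_trans ?_ (ncard_le_ncard hKS hS)
  by_contra! hlt
  have hfin : (frontier K).Finite := hS.subset hKS
  have hpre : IsPreconnected (frontier K)ᶜ := by
    apply hW.1
    rw [← hfin.cast_ncard_eq]
    exact_mod_cast hlt
  have hcover : (frontier K)ᶜ ⊆ interior K ∪ Kᶜ := by
    rw [hK.frontier_eq]
    intro x hx
    by_cases hxK : x ∈ K
    · left
      by_contra h
      exact hx ⟨hxK, h⟩
    · exact Or.inr hxK
  obtain ⟨x, hx⟩ := hInt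
  obtain ⟨y, hy⟩ := hcompl
  have hx' : x ∈ (frontier K)ᶜ := by
    rw [hK.frontier_eq]; exact fun h => h.2 hx
  have hy' : y ∈ (frontier K)ᶜ := by
    rw [hK.frontier_eq]; exact fun h => hy h.1
  obtain ⟨z, -, hz1, hz2⟩ := hpre _ _ isOpen_interior hK.isOpen_compl hcover ⟨x, hx', hx⟩
    ⟨y, hy', hy⟩
  exact hz2 (interior_subset hz1)

theorem IsThick.frontier_eq (hW : IsThick W m) {K S : Set W} (hS : S.Finite) (hSm : S.ncard = m)
    (hK : IsClosed K) (hKS : frontier K ⊆ S) (hInt : (interior K).Nonempty)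
    (hcompl : Kᶜ.Nonempty) : frontier K = S := by
  refine eq_of_subset_of_ncard_le hKS ?_ hS
  rw [hSm]
  exact hW.le_ncard_of_frontier_subset (hS.subset hKS) hK Subset.rfl hInt hcompl

theorem IsDecomposition.symm (h : IsDecomposition A M N) : IsDecomposition A N M :=
  ⟨h.2.1, h.1, by rw [union_comm]; exact h.2.2.1, by rw [inter_comm]; exact h.2.2.2⟩

theorem IsDecomposition.subset_left (h : IsDecomposition A M N) : A ⊆ M :=
  h.2.2.2 ▸ inter_subset_left

theorem IsDecomposition.compl_left (h : IsDecomposition A M N) : Mᶜ = N \ A := by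
  obtain ⟨-, -, hu, rfl⟩ := h
  ext x
  have : x ∈ M ∪ N := hu ▸ mem_univ x
  simp only [mem_compl_iff, Set.mem_sdiff, mem_inter_iff]
  rcases this with h | h <;> tauto

theorem IsMinCut.finite (hA : IsMinCut m A) : A.Finite := finite_of_encard_eq_coe hA.1

theorem IsMinCut.ncard_eq (hA : IsMinCut m A) : A.ncard = m := by
  rw [ncard_def, hA.1]; rfl

theorem IsMinCut.diff_nonempty (hA : IsMinCut m A) (hB : IsMinCut m B) (h : A ≠ B) :
    (A \ B).Nonempty := by
  rw [nonempty_iff_ne_empty]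
  intro he
  exact h (eq_of_subset_of_ncard_le (sdiff_eq_empty.1 he) (by rw [hA.ncard_eq, hB.ncard_eq])
    hB.finite)

theorem IsDecomposition.nontrivial_left (hm : 2 ≤ m) (hA : IsMinCut m A)
    (h : IsDecomposition A M N) : M.Nontrivial := by
  have : A.Nontrivial := by
    rw [← one_lt_ncard_iff_nontrivial_and_finite.trans (and_iff_left hA.finite), hA.ncard_eq]
    exact hm
  exact this.mono h.subset_left

variable [T2Space W]

theorem IsDecomposition.isClosed_left (h : IsDecomposition A M N) : IsClosed M :=
  h.1.1.isClosed

theorem IsDecomposition.isClosed_right (h : IsDecomposition A M N) : IsClosed N :=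
  h.2.1.1.isClosed

theorem IsDecomposition.left_diff_nonempty (hm : 2 ≤ m) (hA : IsMinCut m A)
    (h : IsDecomposition A M N) : (M \ A).Nonempty :=
  ((h.1.2.isPreconnected.infinite_of_nontrivial (h.nontrivial_left hm hA)).sdiff
    hA.finite).nonempty

theorem IsDecomposition.isOpen_diff (h : IsDecomposition A M N) : IsOpen (M \ A) := by
  rw [← h.symm.compl_left]
  exact h.isClosed_right.isOpen_compl

/-- Since `M \ A` is open, the frontier lies in `A`; thickness leaves no room for it to be smaller.
-/
theorem IsDecomposition.frontier_left (hW : IsThick W m) (hm : 2 ≤ m) (hA : IsMinCut m A)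
    (h : IsDecomposition A M N) : frontier M = A := by
  apply hW.frontier_eq hA.finite hA.ncard_eq h.isClosed_left
  · rw [h.isClosed_left.frontier_eq]
    intro x hx
    by_contra hxA
    exact hx.2 (interior_maximal sdiff_subset h.isOpen_diff ⟨hx.1, hxA⟩)
  · exact (h.left_diff_nonempty hm hA).mono (interior_maximal sdiff_subset h.isOpen_diff)
  · rw [h.compl_left]
    exact h.symm.left_diff_nonempty hm hA

theorem IsDecomposition.subset_closure_diff (hW : IsThick W m) (hm : 2 ≤ m) (hA : IsMinCut m A)
    (h : IsDecomposition A M N) : A ⊆ closure (M \ A) := by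
  rw [← h.symm.compl_left]
  conv_lhs => rw [← h.symm.frontier_left hW hm hA, frontier_eq_closure_inter_closure]
  exact inter_subset_right

/-- One side of a min cut stays connected after removing a proper subset of the cut. -/
theorem IsDecomposition.isPreconnected_diff (hW : IsThick W m) (hm : 2 ≤ m) (hA : IsMinCut m A)
    (h : IsDecomposition A M N) {I : Set W} (hI : I ⊆ A) (hIA : (A \ I).Nonempty) :
    IsPreconnected (M \ I) := by
  have hIfin : I.Finite := hA.finite.subset hI
  -- The part of `M \ I` in `U`, with `I` added back, is closed with frontier inside `A`. By
  -- thickness the bound for the frontier is all of `A`, which forces `A \ I ⊆ U`. The same holds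
  -- for `V`, so a splitting is impossible.
  have key : ∀ U V : Set W, IsOpen U → IsOpen V → M \ I ⊆ U ∪ V → ((M \ I) ∩ U).Nonempty →
      ¬ ((M \ I) ∩ (U ∩ V)).Nonempty → A \ I ⊆ U := by
    intro U V hU hV hcov hne hemp
    have hK : (M \ I) ∩ U ∪ I = M ∩ (V \ I)ᶜ := by
      ext x
      constructor
      · rintro (⟨hx, hxU⟩ | hx)
        · exact ⟨hx.1, fun hxV => hemp ⟨x, hx, hxU, hxV.1⟩⟩
        · exact ⟨h.subset_left (hI hx), fun hxV => hxV.2 hx⟩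
      · rintro ⟨hxM, hxV⟩
        by_cases hxI : x ∈ I
        · exact Or.inr hxI
        · refine Or.inl ⟨⟨hxM, hxI⟩, ?_⟩
          rcases hcov ⟨hxM, hxI⟩ with hx | hx
          · exact hx
          · exact absurd ⟨hx, hxI⟩ hxV
    have hKcl : IsClosed ((M \ I) ∩ U ∪ I) := by
      rw [hK]
      exact h.isClosed_left.inter (hV.sdiff hIfin.isClosed).isClosed_compl
    have hopen : IsOpen ((M \ A) ∩ U) := h.isOpen_diff.inter hU
    have hsub : (M \ A) ∩ U ⊆ (M \ I) ∩ U ∪ I := fun x hx =>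
      Or.inl ⟨⟨hx.1.1, fun hxI => hx.1.2 (hI hxI)⟩, hx.2⟩
    have hfr : frontier ((M \ I) ∩ U ∪ I) ⊆ (A ∩ U) ∪ I := by
      rw [hKcl.frontier_eq]
      rintro x ⟨(hx | hx), hx'⟩
      · by_cases hxA : x ∈ A
        · exact Or.inl ⟨hxA, hx.2⟩
        · exact absurd (interior_maximal hsub hopen ⟨⟨hx.1.1, hxA⟩, hx.2⟩) hx'
      · exact Or.inr hx
    have hInt : ((M \ A) ∩ U).Nonempty := by
      obtain ⟨x, hx, hxU⟩ := hne
      by_cases hxA : x ∈ A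
      · obtain ⟨y, hy1, hy2⟩ := mem_closure_iff.1 (h.subset_closure_diff hW hm hA hxA) U hU hxU
        exact ⟨y, hy2, hy1⟩
      · exact ⟨x, ⟨hx.1, hxA⟩, hxU⟩
    have hle := hW.le_ncard_of_frontier_subset
      ((hA.finite.subset inter_subset_left).union hIfin) hKcl hfr
      (hInt.mono (interior_maximal hsub hopen))
      ((h.symm.left_diff_nonempty hm hA).mono (by
        rw [← h.compl_left, compl_subset_compl, hK]; exact inter_subset_left))
    have heq : A ∩ U ∪ I = A :=
      eq_of_subset_of_ncard_le (union_subset inter_subset_left hI)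
        (by rw [hA.ncard_eq]; exact hle) hA.finite
    rintro x ⟨hxA, hxI⟩
    rw [← heq] at hxA
    exact (hxA.resolve_right hxI).2
  intro U V hU hV hcov hneU hneV
  by_contra hemp
  have h1 := key U V hU hV hcov hneU hemp
  have h2 := key V U hV hU (by rwa [union_comm]) hneV (by rwa [inter_comm V U])
  obtain ⟨x, hx⟩ := hIA
  exact hemp ⟨x, ⟨h.subset_left hx.1, hx.2⟩, h1 hx, h2 hx⟩

/-- If `B` is on the side `N` of `A`, then the side `M` is on one side of `B`. -/
theorem IsDecomposition.subset_or_subset (hW : IsThick W m) (hm : 2 ≤ m) (hA : IsMinCut m A)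
    (hB : IsMinCut m B) (hAB : A ≠ B) (h : IsDecomposition A M N) (hBN : B ⊆ N)
    (h' : IsDecomposition B M' N') : M ⊆ M' ∨ M ⊆ N' := by
  -- `M` meets `B` only in `A ∩ B`, a proper subset of `A`; deleting it leaves a connected set that
  -- avoids `B`.
  have hpre : IsPreconnected (M \ (A ∩ B)) := by
    refine h.isPreconnected_diff hW hm hA inter_subset_left ?_
    rw [sdiff_self_inter]
    exact hA.diff_nonempty hB hAB
  have hMB : M ∩ B ⊆ A ∩ B := fun x hx => ⟨h.2.2.2 ▸ ⟨hx.1, hBN hx.2⟩, hx.2⟩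
  have hcov : M \ (A ∩ B) ⊆ (M' \ B) ∪ (N' \ B) := by
    intro x hx
    have hxB : x ∉ B := fun hxB => hx.2 (hMB ⟨hx.1, hxB⟩)
    have : x ∈ M' ∪ N' := h'.2.2.1 ▸ mem_univ x
    exact this.imp (fun h => ⟨h, hxB⟩) fun h => ⟨h, hxB⟩
  have hdisj : Disjoint (M' \ B) (N' \ B) := by
    rw [disjoint_left]
    intro x hx hx'
    exact hx.2 (h'.2.2.2 ▸ ⟨hx.1, hx'.1⟩)
  refine (hpre.subset_or_subset h'.isOpen_diff h'.symm.isOpen_diff hdisj hcov).imp ?_ ?_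
  · intro hs x hx
    by_cases hxI : x ∈ A ∩ B
    · exact h'.subset_left hxI.2
    · exact (hs ⟨hx, hxI⟩).1
  · intro hs x hx
    by_cases hxI : x ∈ A ∩ B
    · exact h'.symm.subset_left hxI.2
    · exact (hs ⟨hx, hxI⟩).1

/-- If moreover some min cut other than `B` lies in `M` and in `M'`, then `M ⊆ M'`. -/
theorem IsDecomposition.subset_of_cut_subset (hW : IsThick W m) (hm : 2 ≤ m)
    (hA : IsMinCut m A) (hB : IsMinCut m B) (hAB : A ≠ B) (h : IsDecomposition A M N)
    (hBN : B ⊆ N) (h' : IsDecomposition B M' N') {C : Set W} (hC : IsMinCut m C) (hCB : C ≠ B)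
    (hCM : C ⊆ M) (hCM' : C ⊆ M') : M ⊆ M' := by
  rcases h.subset_or_subset hW hm hA hB hAB hBN h' with hs | hs
  · exact hs
  · obtain ⟨x, hxC, hxB⟩ := hC.diff_nonempty hB hCB
    exact absurd (h'.2.2.2 ▸ ⟨hCM' hxC, hs (hCM hxC)⟩) hxB

end Cuts

/-! ### The gap between two nested cuts, and wheels made of four continua. -/

section Gaps

variable {W : Type*} [TopologicalSpace W] {M' N' A B M N : Set W} {m : ℕ}

/-- The open gap between two disjoint sides of two min cuts. -/
def gap (M N : Set W) : Set W := (M ∪ N)ᶜ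

/-- Distinct min cuts `A` and `B` with decompositions `M`, `N` and `M'`, `N'` that are nested. -/
structure NestedCuts (m : ℕ) (A M N B M' N' : Set W) : Prop where
  cut_left : IsMinCut m A
  cut_right : IsMinCut m B
  ne : A ≠ B
  dec_left : IsDecomposition A M N
  dec_right : IsDecomposition B M' N'
  left_subset : M ⊆ M'
  right_subset : N' ⊆ N

theorem mem_or_mem_gap_or_mem {α : Type*} (M N : Set α) (x : α) : x ∈ M ∨ x ∈ gap M N ∨ x ∈ N := by
  by_cases h1 : x ∈ M
  · exact Or.inl h1
  · by_cases h2 : x ∈ N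
    · exact Or.inr (Or.inr h2)
    · exact Or.inr (Or.inl fun h => h.elim h1 h2)

theorem gap_comm {α : Type*} (M N : Set α) : gap N M = gap M N := by
  rw [gap, union_comm, gap]

namespace NestedCuts

theorem symm (h : NestedCuts m A M N B M' N') : NestedCuts m B N' M' A N M :=
  ⟨h.cut_right, h.cut_left, h.ne.symm, h.dec_right.symm, h.dec_left.symm, h.right_subset,
    h.left_subset⟩

theorem inter_eq (h : NestedCuts m A M N B M' N') : M ∩ N' = A ∩ B := by
  ext x
  constructor
  · rintro ⟨h1, h2⟩
    exact ⟨h.dec_left.2.2.2 ▸ ⟨h1, h.right_subset h2⟩, h.dec_right.2.2.2 ▸ ⟨h.left_subset h1, h2⟩⟩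
  · rintro ⟨h1, h2⟩
    exact ⟨h.dec_left.subset_left h1, h.dec_right.symm.subset_left h2⟩

theorem gap_subset (h : NestedCuts m A M N B M' N') : gap M N' ⊆ N ∩ M' := by
  intro x hx
  have h1 : x ∈ M ∪ N := h.dec_left.2.2.1 ▸ mem_univ x
  have h2 : x ∈ M' ∪ N' := h.dec_right.2.2.1 ▸ mem_univ x
  exact ⟨h1.resolve_left fun h => hx (Or.inl h), h2.resolve_right fun h => hx (Or.inr h)⟩

theorem gap_subset_region_diff (h : NestedCuts m A M N B M' N') : gap M N' ⊆ (N ∩ M') \ (A ∩ B) :=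
    fun _ hx =>
  ⟨h.gap_subset hx, fun hI => hx (Or.inl (h.inter_eq ▸ hI : _ ∈ M ∩ N').1)⟩

theorem ncard_union_inter (h : NestedCuts m A M N B M' N') : (A ∪ B).ncard + (A ∩ B).ncard = m + m
    := by
  rw [ncard_union_add_ncard_inter _ _ h.cut_left.finite h.cut_right.finite, h.cut_left.ncard_eq,
    h.cut_right.ncard_eq]

variable [T2Space W]

theorem isOpen_gap (h : NestedCuts m A M N B M' N') : IsOpen (gap M N') :=
  (h.dec_left.isClosed_left.union h.dec_right.isClosed_right).isOpen_compl

theorem isClosed_region (h : NestedCuts m A M N B M' N') : IsClosed (N ∩ M') :=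
  h.dec_left.isClosed_right.inter h.dec_right.isClosed_left

theorem closure_gap_subset (h : NestedCuts m A M N B M' N') : closure (gap M N') ⊆ N ∩ M' :=
  closure_minimal h.gap_subset h.isClosed_region

/-- Points of `A` are limits of points outside `M`. Near a point not in `B` the closed set `N'` is
absent, so these nearby points lie in the gap. -/
theorem left_diff_subset_closure (h : NestedCuts m A M N B M' N') (hW : IsThick W m) (hm : 2 ≤ m) :
    A \ B ⊆ closure (gap M N') := by
  intro x hx
  have h1 := h.dec_left.symm.subset_closure_diff hW hm h.cut_left hx.1
  have h2 : x ∈ N'ᶜ := fun hN =>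
    hx.2 (h.inter_eq.subset ⟨h.dec_left.subset_left hx.1, hN⟩).2
  rw [← h.dec_left.compl_left] at h1
  have h3 : gap M N' = Mᶜ ∩ N'ᶜ := compl_union M N'
  rw [h3]
  exact mem_closure_iff.2 fun O hO hxO => by
    obtain ⟨y, ⟨hy1, hy2⟩, hy3⟩ := mem_closure_iff.1 h1 (O ∩ N'ᶜ)
      (hO.inter h.dec_right.isClosed_right.isOpen_compl) ⟨hxO, h2⟩
    exact ⟨y, hy1, hy3, hy2⟩

theorem region_diff_subset_closure (h : NestedCuts m A M N B M' N') (hW : IsThick W m) (hm : 2 ≤ m)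
    :
    (N ∩ M') \ (A ∩ B) ⊆ closure (gap M N') := by
  rintro x ⟨⟨hxN, hxM'⟩, hxI⟩
  rcases mem_or_mem_gap_or_mem M N' x with hx | hx | hx
  · have hxA : x ∈ A := h.dec_left.2.2.2 ▸ ⟨hx, hxN⟩
    exact h.left_diff_subset_closure hW hm ⟨hxA, fun hxB => hxI ⟨hxA, hxB⟩⟩
  · exact subset_closure hx
  · have hxB : x ∈ B := h.dec_right.2.2.2 ▸ ⟨hxM', hx⟩
    rw [← gap_comm]
    exact h.symm.left_diff_subset_closure hW hm ⟨hxB, fun hxA => hxI ⟨hxA, hxB⟩⟩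

theorem gap_nonempty (h : NestedCuts m A M N B M' N') (hW : IsThick W m) (hm : 2 ≤ m) :
    (gap M N').Nonempty := by
  rw [← closure_nonempty_iff]
  exact (h.cut_left.diff_nonempty h.cut_right h.ne).mono (h.left_diff_subset_closure hW hm)

theorem closure_region_diff (h : NestedCuts m A M N B M' N') (hW : IsThick W m) (hm : 2 ≤ m) :
    closure ((N ∩ M') \ (A ∩ B)) = closure (gap M N') :=
  Subset.antisymm (closure_minimal (h.region_diff_subset_closure hW hm) isClosed_closure)
    (closure_mono h.gap_subset_region_diff)

theorem closure_gap_diff_subset (h : NestedCuts m A M N B M' N') : closure (gap M N') \ gap M N'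
    ⊆ A ∪ B := by
  rintro x ⟨hx, hx'⟩
  have hx2 := h.closure_gap_subset hx
  rcases mem_or_mem_gap_or_mem M N' x with h1 | h1 | h1
  · exact Or.inl (h.dec_left.2.2.2 ▸ ⟨h1, hx2.1⟩)
  · exact absurd h1 hx'
  · exact Or.inr (h.dec_right.2.2.2 ▸ ⟨hx2.2, h1⟩)

theorem frontier_closure_gap_subset (h : NestedCuts m A M N B M' N') :
    frontier (closure (gap M N')) ⊆ (A ∪ B) \ ((A ∩ B) \ closure (gap M N')) := by
  rw [isClosed_closure.frontier_eq]
  rintro x ⟨hx, hx'⟩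
  refine ⟨h.closure_gap_diff_subset ⟨hx, fun hg => hx' ?_⟩, fun h' => h'.2 hx⟩
  exact interior_maximal subset_closure h.isOpen_gap hg

theorem interior_closure_gap_nonempty (h : NestedCuts m A M N B M' N') (hW : IsThick W m)
    (hm : 2 ≤ m) :
    (interior (closure (gap M N'))).Nonempty :=
  (h.gap_nonempty hW hm).mono (interior_maximal subset_closure h.isOpen_gap)

theorem compl_closure_gap_nonempty (h : NestedCuts m A M N B M' N') (hm : 2 ≤ m) :
    (closure (gap M N'))ᶜ.Nonempty := by
  obtain ⟨x, hxM, hxA⟩ := h.dec_left.left_diff_nonempty hm h.cut_left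
  exact ⟨x, fun hx => hxA (h.dec_left.2.2.2 ▸ ⟨hxM, (h.closure_gap_subset hx).1⟩)⟩

/-- At most half of the points of a min cut are isolated in the region between two min cuts. -/
theorem two_mul_ncard_isolated_le (h : NestedCuts m A M N B M' N') (hW : IsThick W m) (hm : 2 ≤ m) :
    2 * ((A ∩ B) \ closure (gap M N')).ncard ≤ m := by
  have hfin : (A ∪ B).Finite := h.cut_left.finite.union h.cut_right.finite
  -- With `D` the isolated set, the frontier bound reads `m ≤ |A ∪ B| - |D| = 2m - |A ∩ B| - |D|`,
  -- and `D ⊆ A ∩ B`.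
  have h1 := hW.le_ncard_of_frontier_subset (hfin.sdiff (t := (A ∩ B) \ closure (gap M N')))
    isClosed_closure h.frontier_closure_gap_subset (h.interior_closure_gap_nonempty hW hm)
    (h.compl_closure_gap_nonempty hm)
  have hsub : (A ∩ B) \ closure (gap M N') ⊆ A ∪ B := fun x hx => Or.inl hx.1.1
  have h2 := ncard_sdiff_add_ncard_of_subset hsub hfin
  have h3 := h.ncard_union_inter
  have h4 : ((A ∩ B) \ closure (gap M N')).ncard ≤ (A ∩ B).ncard :=
    ncard_le_ncard sdiff_subset (h.cut_left.finite.inter_of_left _)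
  omega

end NestedCuts

/-- Four continua in cyclic order form a finite wheel. -/
theorem isFiniteWheel_of_four {F I Y₀ Y₁ Y₂ Y₃ : Set W} (hF : F.Finite)
    (hY₀ : IsSubcontinuum Y₀ ∧ Y₀.Nontrivial) (hY₁ : IsSubcontinuum Y₁ ∧ Y₁.Nontrivial)
    (hY₂ : IsSubcontinuum Y₂ ∧ Y₂.Nontrivial) (hY₃ : IsSubcontinuum Y₃ ∧ Y₃.Nontrivial)
    (hU : ∀ x, x ∈ Y₀ ∨ x ∈ Y₁ ∨ x ∈ Y₂ ∨ x ∈ Y₃)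
    (h02 : Y₀ ∩ Y₂ = I) (h13 : Y₁ ∩ Y₃ = I) (hI : I.encard < m)
    (hFeq : F = (Y₀ ∩ Y₁ ∪ Y₁ ∩ Y₂) ∪ (Y₂ ∩ Y₃ ∪ Y₃ ∩ Y₀))
    (hf₀ : (frontier Y₀).encard = m) (hf₁ : (frontier Y₁).encard = m)
    (hf₂ : (frontier Y₂).encard = m) (hf₃ : (frontier Y₃).encard = m) :
    IsFiniteWheel m F := by
  set Y : ZMod 4 → Set W := ![Y₀, Y₁, Y₂, Y₃] with hY
  have hall : ∀ {p : Set W → Prop}, p Y₀ → p Y₁ → p Y₂ → p Y₃ → ∀ i, p (Y i) := by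
    intro p h0 h1 h2 h3 i
    fin_cases i <;> assumption
  have hinter : ⋂ i, Y i = I := by
    apply Subset.antisymm
    · intro x hx
      rw [← h02]
      exact ⟨mem_iInter.1 hx 0, mem_iInter.1 hx 2⟩
    · refine subset_iInter (hall (p := fun Z => I ⊆ Z) ?_ ?_ ?_ ?_)
      · rw [← h02]; exact inter_subset_left
      · rw [← h13]; exact inter_subset_left
      · rw [← h02]; exact inter_subset_right
      · rw [← h13]; exact inter_subset_right
  refine ⟨4, by norm_num, Y, ⟨hF, hall (p := fun Z => IsSubcontinuum Z ∧ Z.Nontrivial) hY₀ hY₁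
    hY₂ hY₃, ?_, ?_⟩, by rwa [hinter], ?_, hall (p := fun Z => (frontier Z).encard = m) hf₀ hf₁
    hf₂ hf₃⟩
  · refine eq_univ_of_forall fun x => mem_iUnion.2 ?_
    rcases hU x with h | h | h | h
    exacts [⟨0, h⟩, ⟨1, h⟩, ⟨2, h⟩, ⟨3, h⟩]
  · have hI1 : I ⊆ F := by
      intro x hx
      have h1 : x ∈ Y₀ ∩ Y₂ := h02 ▸ hx
      have h2 : x ∈ Y₁ ∩ Y₃ := h13 ▸ hx
      rw [hFeq]
      exact Or.inl (Or.inl ⟨h1.1, h2.1⟩)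
    have h01 : Y₀ ∩ Y₁ ⊆ F := fun x hx => hFeq ▸ Or.inl (Or.inl hx)
    have h12 : Y₁ ∩ Y₂ ⊆ F := fun x hx => hFeq ▸ Or.inl (Or.inr hx)
    have h23 : Y₂ ∩ Y₃ ⊆ F := fun x hx => hFeq ▸ Or.inr (Or.inl hx)
    have h30 : Y₃ ∩ Y₀ ⊆ F := fun x hx => hFeq ▸ Or.inr (Or.inr hx)
    rw [← h02] at hI1
    have hI2 : Y₁ ∩ Y₃ ⊆ F := by rwa [h13, ← h02]
    ext x
    constructor
    · rintro ⟨i, j, hij, hx⟩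
      fin_cases i <;> fin_cases j <;> first
        | exact absurd rfl hij
        | exact hI1 hx
        | exact hI1 hx.symm
        | exact hI2 hx
        | exact hI2 hx.symm
        | exact h01 hx
        | exact h01 hx.symm
        | exact h12 hx
        | exact h12 hx.symm
        | exact h23 hx
        | exact h23 hx.symm
        | exact h30 hx
        | exact h30 hx.symm
    · rw [hFeq]
      rintro ((hx | hx) | (hx | hx))
      exacts [⟨0, 1, by decide, hx⟩, ⟨1, 2, by decide, hx⟩, ⟨2, 3, by decide, hx⟩,
        ⟨3, 0, by decide, hx⟩]
  · rw [hinter]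
    intro i j
    fin_cases i <;> fin_cases j <;> intro h1 h2 h3 <;> first
      | exact absurd rfl h1
      | exact absurd rfl h2
      | exact absurd rfl h3
      | exact h02
      | exact h13
      | exact (inter_comm _ _).trans h02
      | exact (inter_comm _ _).trans h13

end Gaps

/-! ### A split region between two cuts yields a wheel. -/

section Splits

variable {W : Type*} [TopologicalSpace W] {M' N' A B M N U V : Set W} {m : ℕ}

/-- The open sets `U` and `V` disconnect `T`. -/
structure IsSplit (T U V : Set W) : Prop where
  isOpen_left : IsOpen U
  isOpen_right : IsOpen V
  cover : T ⊆ U ∪ V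
  left_nonempty : (T ∩ U).Nonempty
  right_nonempty : (T ∩ V).Nonempty
  disjoint : ∀ x ∈ T, x ∈ U → x ∉ V

theorem exists_isSplit {T : Set W} (h : ¬ IsPreconnected T) : ∃ U V, IsSplit T U V := by
  simp only [IsPreconnected, not_forall] at h
  obtain ⟨U, V, hU, hV, hc, h1, h2, h3⟩ := h
  exact ⟨U, V, hU, hV, hc, h1, h2, fun x hx hxU hxV => h3 ⟨x, hx, hxU, hxV⟩⟩

theorem IsSplit.symm {T : Set W} (h : IsSplit T U V) : IsSplit T V U :=
  ⟨h.isOpen_right, h.isOpen_left, by rw [union_comm]; exact h.cover, h.right_nonempty,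
    h.left_nonempty, fun x hx h1 h2 => h.disjoint x hx h2 h1⟩

/-- The points of two min cuts that lie in `U` or in both cuts. -/
def ends (A B U : Set W) : Set W := (A \ B ∩ U) ∪ (B \ A ∩ U) ∪ (A ∩ B)

theorem ncard_ends_le {α : Type*} (A B U : Set α) :
    (ends A B U).ncard ≤ (A \ B ∩ U).ncard + (B \ A ∩ U).ncard + (A ∩ B).ncard :=
  (ncard_union_le _ _).trans (by gcongr; exact ncard_union_le _ _)

theorem ncard_diff_inter_add (hA : IsMinCut m A) (hcov : A \ B ⊆ U ∪ V)
    (hdisj : ∀ x ∈ A \ B, x ∈ U → x ∉ V) :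
    (A \ B ∩ U).ncard + (A \ B ∩ V).ncard + (A ∩ B).ncard = m := by
  have hf : (A \ B).Finite := hA.finite.sdiff
  rw [← ncard_union_eq _ (hf.inter_of_left _) (hf.inter_of_left _), ← inter_union_distrib_left,
    inter_eq_left.2 hcov, ← hA.ncard_eq, add_comm, ncard_inter_add_ncard_sdiff_eq_ncard _ _
        hA.finite]
  rw [disjoint_left]
  exact fun x hx hx' => hdisj x hx.1 hx.2 hx'.2

namespace NestedCuts

theorem mem_region_cases (h : NestedCuts m A M N B M' N') {x : W}
    (hx : x ∈ (N ∩ M') \ (A ∩ B)) : x ∈ gap M N' ∨ x ∈ A \ B ∨ x ∈ B \ A := by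
  obtain ⟨⟨hxN, hxM'⟩, hxI⟩ := hx
  rcases mem_or_mem_gap_or_mem M N' x with hx | hx | hx
  · have hxA : x ∈ A := h.dec_left.2.2.2 ▸ ⟨hx, hxN⟩
    exact Or.inr (Or.inl ⟨hxA, fun hxB => hxI ⟨hxA, hxB⟩⟩)
  · exact Or.inl hx
  · have hxB : x ∈ B := h.dec_right.2.2.2 ▸ ⟨hxM', hx⟩
    exact Or.inr (Or.inr ⟨hxB, fun hxA => hxI ⟨hxA, hxB⟩⟩)

theorem left_diff_subset_region (h : NestedCuts m A M N B M' N') :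
    A \ B ⊆ (N ∩ M') \ (A ∩ B) := fun _ hx =>
  ⟨⟨h.dec_left.symm.subset_left hx.1, h.left_subset (h.dec_left.subset_left hx.1)⟩,
    fun hI => hx.2 hI.2⟩

theorem right_diff_subset_region (h : NestedCuts m A M N B M' N') :
    B \ A ⊆ (N ∩ M') \ (A ∩ B) := fun _ hx =>
  ⟨⟨h.right_subset (h.dec_right.symm.subset_left hx.1), h.dec_right.subset_left hx.1⟩,
    fun hI => hx.2 hI.1⟩

theorem finite_ends (h : NestedCuts m A M N B M' N') (U : Set W) : (ends A B U).Finite :=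
  (((h.cut_left.finite.sdiff).inter_of_left _).union ((h.cut_right.finite.sdiff).inter_of_left
      _)).union
    (h.cut_left.finite.inter_of_left _)

theorem inter_ncard_lt (h : NestedCuts m A M N B M' N') : (A ∩ B).ncard < m := by
  have h1 := (ncard_pos h.cut_left.finite.sdiff).2 (h.cut_left.diff_nonempty h.cut_right h.ne)
  have h2 := ncard_inter_add_ncard_sdiff_eq_ncard A B h.cut_left.finite
  rw [h.cut_left.ncard_eq] at h2
  omega

variable [T2Space W]

theorem region_inter_subset_closure (h : NestedCuts m A M N B M' N') (hW : IsThick W m)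
    (hm : 2 ≤ m) (hU : IsOpen U) : (N ∩ M') \ (A ∩ B) ∩ U ⊆ closure (gap M N' ∩ U) := by
  rintro x ⟨hx, hxU⟩
  rw [mem_closure_iff]
  intro O hO hxO
  obtain ⟨y, ⟨hy1, hy2⟩, hy3⟩ := mem_closure_iff.1 (h.region_diff_subset_closure hW hm hx)
    (O ∩ U) (hO.inter hU) ⟨hxO, hxU⟩
  exact ⟨y, hy1, hy3, hy2⟩

theorem closure_split_subset (h : NestedCuts m A M N B M' N')
    (hs : IsSplit ((N ∩ M') \ (A ∩ B)) U V) {x : W} (hx : x ∈ closure (gap M N' ∩ U)) :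
    x ∈ (N ∩ M') \ (A ∩ B) ∩ U ∨ x ∈ A ∩ B := by
  by_cases hxI : x ∈ A ∩ B
  · exact Or.inr hxI
  · have hxT : x ∈ (N ∩ M') \ (A ∩ B) :=
      ⟨h.closure_gap_subset (closure_mono inter_subset_left hx), hxI⟩
    refine Or.inl ⟨hxT, (hs.cover hxT).resolve_right fun hxV => ?_⟩
    obtain ⟨y, hyV, hyg, hyU⟩ := mem_closure_iff.1 hx V hs.isOpen_right hxV
    exact hs.disjoint y (h.gap_subset_region_diff hyg) hyU hyV

theorem closure_split_cases (h : NestedCuts m A M N B M' N')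
    (hs : IsSplit ((N ∩ M') \ (A ∩ B)) U V) {x : W} (hx : x ∈ closure (gap M N' ∩ U)) :
    x ∈ gap M N' ∩ U ∨ x ∈ A \ B ∩ U ∨ x ∈ B \ A ∩ U ∨ x ∈ A ∩ B := by
  rcases h.closure_split_subset hs hx with ⟨h1, h2⟩ | h1
  · rcases h.mem_region_cases h1 with h3 | h3 | h3
    exacts [Or.inl ⟨h3, h2⟩, Or.inr (Or.inl ⟨h3, h2⟩), Or.inr (Or.inr (Or.inl ⟨h3, h2⟩))]
  · exact Or.inr (Or.inr (Or.inr h1))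

theorem gap_inter_nonempty (h : NestedCuts m A M N B M' N') (hW : IsThick W m)
    (hm : 2 ≤ m) (hs : IsSplit ((N ∩ M') \ (A ∩ B)) U V) : (gap M N' ∩ U).Nonempty := by
  rw [← closure_nonempty_iff]
  exact hs.left_nonempty.mono (h.region_inter_subset_closure hW hm hs.isOpen_left)

theorem frontier_split_subset (h : NestedCuts m A M N B M' N')
    (hs : IsSplit ((N ∩ M') \ (A ∩ B)) U V) :
    frontier (closure (gap M N' ∩ U)) ⊆ ends A B U := by
  rw [isClosed_closure.frontier_eq]
  rintro x ⟨hx, hx'⟩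
  rcases h.closure_split_cases hs hx with h1 | h1 | h1 | h1
  · exact absurd (interior_maximal subset_closure (h.isOpen_gap.inter hs.isOpen_left) h1) hx'
  · exact Or.inl (Or.inl h1)
  · exact Or.inl (Or.inr h1)
  · exact Or.inr h1

theorem disjoint_closure_split (h : NestedCuts m A M N B M' N')
    (hs : IsSplit ((N ∩ M') \ (A ∩ B)) U V) {x : W} (hx : x ∈ closure (gap M N' ∩ U)) :
    x ∉ gap M N' ∩ V := by
  rintro ⟨hxg, hxV⟩
  rcases h.closure_split_subset hs hx with h1 | h1
  · exact hs.disjoint x h1.1 h1.2 hxV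
  · exact (h.gap_subset_region_diff hxg).2 h1

/-- Thickness applied to the closure of the half of the gap in `U`; the other half provides the
complement. -/
theorem le_ncard_ends (h : NestedCuts m A M N B M' N') (hW : IsThick W m)
    (hm : 2 ≤ m) (hs : IsSplit ((N ∩ M') \ (A ∩ B)) U V) :
    m ≤ (frontier (closure (gap M N' ∩ U))).ncard ∧
    m ≤ (A \ B ∩ U).ncard + (B \ A ∩ U).ncard + (A ∩ B).ncard := by
  have hf := (h.finite_ends U).subset (h.frontier_split_subset hs)
  have := hW.le_ncard_of_frontier_subset hf isClosed_closure Subset.rfl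
    ((h.gap_inter_nonempty hW hm hs).mono
      (interior_maximal subset_closure (h.isOpen_gap.inter hs.isOpen_left)))
    ((h.gap_inter_nonempty hW hm hs.symm).mono
      fun x hx hx' => h.disjoint_closure_split hs hx' hx)
  exact ⟨this, this.trans ((ncard_le_ncard (h.frontier_split_subset hs) (h.finite_ends U)).trans
    (ncard_ends_le A B U))⟩

/-- Thickness applied to `M` glued to the half of the gap in `U`. Gluing makes the points of `A \ B`
in `U` interior, so the frontier crosses over: from `A` only the points in `V` or in `B` remain,
from `B` those in `U` or in `A`. -/
theorem le_ncard_crossing (h : NestedCuts m A M N B M' N') (hW : IsThick W m)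
    (hm : 2 ≤ m) (hs : IsSplit ((N ∩ M') \ (A ∩ B)) U V) :
    m ≤ (A \ B ∩ V).ncard + (B \ A ∩ U).ncard + (A ∩ B).ncard := by
  have hfin : (A \ B ∩ V ∪ B \ A ∩ U ∪ A ∩ B).Finite :=
    ((h.cut_left.finite.sdiff.inter_of_left _).union
      (h.cut_right.finite.sdiff.inter_of_left _)).union (h.cut_left.finite.inter_of_left _)
  have hop : IsOpen (U ∩ N'ᶜ) := hs.isOpen_left.inter h.dec_right.isClosed_right.isOpen_compl
  have hsub : U ∩ N'ᶜ ⊆ M ∪ closure (gap M N' ∩ U) := by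
    rintro x ⟨hxU, hxN'⟩
    rcases mem_or_mem_gap_or_mem M N' x with h1 | h1 | h1
    · exact Or.inl h1
    · exact Or.inr (subset_closure ⟨h1, hxU⟩)
    · exact absurd h1 hxN'
  have hleft : M \ A ⊆ M ∪ closure (gap M N' ∩ U) := fun x hx => Or.inl hx.1
  have hcl : IsClosed (M ∪ closure (gap M N' ∩ U)) :=
    h.dec_left.isClosed_left.union isClosed_closure
  have hle := hW.le_ncard_of_frontier_subset (K := M ∪ closure (gap M N' ∩ U)) hfin hcl ?_
    ((h.dec_left.left_diff_nonempty hm h.cut_left).mono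
      (interior_maximal hleft h.dec_left.isOpen_diff)) ?_
  · exact hle.trans ((ncard_union_le _ _).trans (by gcongr; exact ncard_union_le _ _))
  · rw [hcl.frontier_eq]
    rintro x ⟨hx, hx'⟩
    have hxU : ¬ (x ∈ U ∧ x ∉ N') := fun hh => hx' (interior_maximal hsub hop hh)
    rcases hx with hx | hx
    · have hxA : x ∈ A := by
        by_contra hxA
        exact hx' (interior_maximal hleft h.dec_left.isOpen_diff ⟨hx, hxA⟩)
      by_cases hxB : x ∈ B
      · exact Or.inr ⟨hxA, hxB⟩
      · have hxN' : x ∉ N' := fun hN => hxB (h.inter_eq.subset ⟨hx, hN⟩).2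
        refine Or.inl (Or.inl ⟨⟨hxA, hxB⟩, ?_⟩)
        exact (hs.cover (h.left_diff_subset_region ⟨hxA, hxB⟩)).resolve_left fun hU =>
          hxU ⟨hU, hxN'⟩
    · rcases h.closure_split_cases hs hx with h1 | h1 | h1 | h1
      · exact absurd ⟨h1.2, fun hN => h1.1 (Or.inr hN)⟩ hxU
      · refine absurd ⟨h1.2, fun hN => h1.1.2 ?_⟩ hxU
        exact (h.inter_eq.subset ⟨h.dec_left.subset_left h1.1.1, hN⟩).2
      · exact Or.inl (Or.inr h1)
      · exact Or.inr h1
  · refine (h.gap_inter_nonempty hW hm hs.symm).mono ?_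
    rintro x hx (hx' | hx')
    · exact hx.1 (Or.inl hx')
    · exact h.disjoint_closure_split hs hx' hx

/-- The bounds for the two halves add up to exactly `2m`, as do the two crossing bounds, because
each cut is divided between `U` and `V`. Hence all four are equalities, and comparing them shows
that each cut is halved. -/
theorem split_ncard_eq (h : NestedCuts m A M N B M' N') (hW : IsThick W m)
    (hm : 2 ≤ m) (hs : IsSplit ((N ∩ M') \ (A ∩ B)) U V) :
    2 * (A \ B ∩ U).ncard + (A ∩ B).ncard = m ∧
      (A \ B ∩ U).ncard + (B \ A ∩ U).ncard + (A ∩ B).ncard = m := by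
  have h1 := (h.le_ncard_ends hW hm hs).2
  have h2 := (h.le_ncard_ends hW hm hs.symm).2
  have h3 := h.le_ncard_crossing hW hm hs
  have h4 := h.le_ncard_crossing hW hm hs.symm
  have h5 := ncard_diff_inter_add h.cut_left (h.left_diff_subset_region.trans hs.cover)
    fun x hx => hs.disjoint x (h.left_diff_subset_region hx)
  have h6 := ncard_diff_inter_add h.cut_right (h.right_diff_subset_region.trans hs.cover)
    fun x hx => hs.disjoint x (h.right_diff_subset_region hx)
  rw [inter_comm B A] at h6
  omega

theorem frontier_split_eq (h : NestedCuts m A M N B M' N') (hW : IsThick W m)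
    (hm : 2 ≤ m) (hs : IsSplit ((N ∩ M') \ (A ∩ B)) U V) :
    frontier (closure (gap M N' ∩ U)) = ends A B U ∧ (ends A B U).ncard = m := by
  have h1 := (h.le_ncard_ends hW hm hs).1
  have h2 := ncard_ends_le A B U
  rw [(h.split_ncard_eq hW hm hs).2] at h2
  have h3 : frontier (closure (gap M N' ∩ U)) = ends A B U :=
    eq_of_subset_of_ncard_le (h.frontier_split_subset hs) (h2.trans h1) (h.finite_ends U)
  rw [h3] at h1
  exact ⟨h3, le_antisymm h2 h1⟩

/-- A further splitting of the half in `U` would be two coarser splittings of the whole region, each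
piece again with half of `A \ B`. Two disjoint such pieces fit into one half only if `A \ B` is
empty. -/
theorem isPreconnected_split (h : NestedCuts m A M N B M' N') (hW : IsThick W m)
    (hm : 2 ≤ m) (hs : IsSplit ((N ∩ M') \ (A ∩ B)) U V) :
    IsPreconnected ((N ∩ M') \ (A ∩ B) ∩ U) := by
  by_contra hcon
  obtain ⟨U₁, V₁, hs₁⟩ := exists_isSplit hcon
  have key : ∀ {U₁ V₁ : Set W}, IsSplit ((N ∩ M') \ (A ∩ B) ∩ U) U₁ V₁ →
      2 * (A \ B ∩ (U ∩ U₁)).ncard + (A ∩ B).ncard = m := by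
    intro U₁ V₁ hs₁
    refine (h.split_ncard_eq (V := U ∩ V₁ ∪ V) hW hm ⟨hs.isOpen_left.inter hs₁.isOpen_left,
      (hs.isOpen_left.inter hs₁.isOpen_right).union hs.isOpen_right, ?_, ?_, ?_, ?_⟩).1
    · intro x hx
      rcases hs.cover hx with h1 | h1
      · rcases hs₁.cover ⟨hx, h1⟩ with h2 | h2
        exacts [Or.inl ⟨h1, h2⟩, Or.inr (Or.inl ⟨h1, h2⟩)]
      · exact Or.inr (Or.inr h1)
    · rw [← inter_assoc]
      exact hs₁.left_nonempty
    · exact hs.right_nonempty.mono (inter_subset_inter_right _ subset_union_right)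
    · rintro x hx ⟨h1, h2⟩ (h3 | h3)
      · exact hs₁.disjoint x ⟨hx, h1⟩ h2 h3.2
      · exact hs.disjoint x hx h1 h3
  have h1 := key hs₁
  have h2 := key hs₁.symm
  have h3 := (h.split_ncard_eq hW hm hs).1
  have h4 : (A \ B ∩ (U ∩ U₁)).ncard + (A \ B ∩ (U ∩ V₁)).ncard ≤ (A \ B ∩ U).ncard := by
    have hf : (A \ B).Finite := h.cut_left.finite.sdiff
    rw [← ncard_union_eq _ (hf.inter_of_left _) (hf.inter_of_left _)]
    · exact ncard_le_ncard (union_subset (fun x hx => ⟨hx.1, hx.2.1⟩) fun x hx => ⟨hx.1, hx.2.1⟩)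
        (hf.inter_of_left _)
    · rw [disjoint_left]
      exact fun x hx hx' => hs₁.disjoint x ⟨h.left_diff_subset_region hx.1, hx.2.1⟩ hx.2.2 hx'.2.2
  have h5 := h.inter_ncard_lt
  omega

theorem closure_split_eq (h : NestedCuts m A M N B M' N') (hW : IsThick W m)
    (hm : 2 ≤ m) (hs : IsSplit ((N ∩ M') \ (A ∩ B)) U V) :
    closure (gap M N' ∩ U) = (N ∩ M') \ (A ∩ B) ∩ U ∪ A ∩ B := by
  apply Subset.antisymm
  · intro x hx
    exact h.closure_split_subset hs hx
  · refine union_subset (h.region_inter_subset_closure hW hm hs.isOpen_left) fun x hx => ?_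
    have : x ∈ ends A B U := Or.inr hx
    rw [← (h.frontier_split_eq hW hm hs).1, isClosed_closure.frontier_eq] at this
    exact this.1

theorem isSubcontinuum_split [CompactSpace W] (h : NestedCuts m A M N B M' N')
    (hW : IsThick W m) (hm : 2 ≤ m) (hs : IsSplit ((N ∩ M') \ (A ∩ B)) U V) :
    IsSubcontinuum (closure (gap M N' ∩ U)) ∧ (closure (gap M N' ∩ U)).Nontrivial := by
  have h1 : closure (gap M N' ∩ U) = closure ((N ∩ M') \ (A ∩ B) ∩ U) :=
    Subset.antisymm (closure_mono (inter_subset_inter_left _ h.gap_subset_region_diff))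
      (closure_minimal (h.region_inter_subset_closure hW hm hs.isOpen_left) isClosed_closure)
  refine ⟨⟨isClosed_closure.isCompact, (h.gap_inter_nonempty hW hm hs).closure, ?_⟩, ?_⟩
  · rw [h1]
    exact (h.isPreconnected_split hW hm hs).closure
  · obtain ⟨h2, h3⟩ := h.frontier_split_eq hW hm hs
    have h4 : ends A B U ⊆ closure (gap M N' ∩ U) := by
      rw [← h2, isClosed_closure.frontier_eq]; exact sdiff_subset
    refine Set.Nontrivial.mono ?_ h4
    rw [← one_lt_ncard_iff_nontrivial_and_finite.trans (and_iff_left (h.finite_ends U)), h3]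
    exact hm

theorem encard_frontier_left (h : NestedCuts m A M N B M' N') (hW : IsThick W m)
    (hm : 2 ≤ m) : (frontier M).encard = m := by
  rw [h.dec_left.frontier_left hW hm h.cut_left, h.cut_left.1]

theorem encard_frontier_split (h : NestedCuts m A M N B M' N') (hW : IsThick W m)
    (hm : 2 ≤ m) (hs : IsSplit ((N ∩ M') \ (A ∩ B)) U V) :
    (frontier (closure (gap M N' ∩ U))).encard = m := by
  obtain ⟨h1, h2⟩ := h.frontier_split_eq hW hm hs
  rw [h1, ← (h.finite_ends U).cast_ncard_eq, h2]

/-- If the region between two min cuts is disconnected away from their common points, then the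
cuts lie in a wheel. -/
theorem isFiniteWheel_of_split [CompactSpace W] (h : NestedCuts m A M N B M' N')
    (hW : IsThick W m) (hm : 2 ≤ m) (hs : IsSplit ((N ∩ M') \ (A ∩ B)) U V) :
    IsFiniteWheel m (A ∪ B) := by
  have hsub : ∀ x ∈ A ∩ B, x ∈ M ∧ x ∈ N ∧ x ∈ M' ∧ x ∈ N' := fun x hx =>
    ⟨h.dec_left.subset_left hx.1, h.dec_left.symm.subset_left hx.1, h.dec_right.subset_left hx.2,
      h.dec_right.symm.subset_left hx.2⟩
  have hA : ∀ x, x ∈ A ↔ x ∈ M ∧ x ∈ N := fun x => by rw [← h.dec_left.2.2.2]; rfl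
  have hB : ∀ x, x ∈ B ↔ x ∈ M' ∧ x ∈ N' := fun x => by rw [← h.dec_right.2.2.2]; rfl
  have eU := h.closure_split_eq hW hm hs
  have eV := h.closure_split_eq hW hm hs.symm
  -- Cyclic order: left side, `U` half, right side, `V` half. Opposite pieces meet exactly in the
  -- common points of the cuts.
  refine isFiniteWheel_of_four (I := A ∩ B) (Y₀ := M) (Y₁ := closure (gap M N' ∩ U)) (Y₂ := N')
    (Y₃ := closure (gap M N' ∩ V)) (h.cut_left.finite.union h.cut_right.finite)
    ⟨h.dec_left.1, h.dec_left.nontrivial_left hm h.cut_left⟩ (h.isSubcontinuum_split hW hm hs)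
    ⟨h.dec_right.2.1, h.dec_right.symm.nontrivial_left hm h.cut_right⟩
    (h.isSubcontinuum_split hW hm hs.symm) ?_ h.inter_eq ?_ ?_ ?_ (h.encard_frontier_left hW hm)
    (h.encard_frontier_split hW hm hs) (h.symm.encard_frontier_left hW hm)
    (h.encard_frontier_split hW hm hs.symm)
  · intro x
    rcases mem_or_mem_gap_or_mem M N' x with h1 | h1 | h1
    · exact Or.inl h1
    · rcases hs.cover (h.gap_subset_region_diff h1) with h2 | h2
      · exact Or.inr (Or.inl (subset_closure ⟨h1, h2⟩))
      · exact Or.inr (Or.inr (Or.inr (subset_closure ⟨h1, h2⟩)))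
    · exact Or.inr (Or.inr (Or.inl h1))
  · rw [eU, eV]
    ext x
    have := hs.disjoint x
    simp only [mem_inter_iff, mem_union] at *
    tauto
  · rw [← (h.cut_left.finite.inter_of_left _).cast_ncard_eq]
    exact_mod_cast h.inter_ncard_lt
  · rw [eU, eV]
    apply Subset.antisymm
    · intro x hx
      by_cases hxI : x ∈ A ∩ B
      · exact Or.inl (Or.inl ⟨(hsub x hxI).1, Or.inr hxI⟩)
      · rcases hx with hxA | hxB
        · have hxT := h.left_diff_subset_region ⟨hxA, fun hxB => hxI ⟨hxA, hxB⟩⟩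
          rcases hs.cover hxT with h1 | h1
          · exact Or.inl (Or.inl ⟨((hA x).1 hxA).1, Or.inl ⟨hxT, h1⟩⟩)
          · exact Or.inr (Or.inr ⟨Or.inl ⟨hxT, h1⟩, ((hA x).1 hxA).1⟩)
        · have hxT := h.right_diff_subset_region ⟨hxB, fun hxA => hxI ⟨hxA, hxB⟩⟩
          rcases hs.cover hxT with h1 | h1
          · exact Or.inl (Or.inr ⟨Or.inl ⟨hxT, h1⟩, ((hB x).1 hxB).2⟩)
          · exact Or.inr (Or.inl ⟨((hB x).1 hxB).2, Or.inl ⟨hxT, h1⟩⟩)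
    · have hleft : ∀ {Z : Set W} {x : W}, x ∈ M → x ∈ (N ∩ M') \ (A ∩ B) ∩ Z ∪ A ∩ B →
          x ∈ A ∪ B := by
        rintro Z x hxM (hx | hx)
        exacts [Or.inl ((hA x).2 ⟨hxM, hx.1.1.1⟩), Or.inl hx.1]
      have hright : ∀ {Z : Set W} {x : W}, x ∈ N' → x ∈ (N ∩ M') \ (A ∩ B) ∩ Z ∪ A ∩ B →
          x ∈ A ∪ B := by
        rintro Z x hxN (hx | hx)
        exacts [Or.inr ((hB x).2 ⟨hx.1.1.2, hxN⟩), Or.inl hx.1]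
      rintro x ((hx | hx) | (hx | hx))
      exacts [hleft hx.1 hx.2, hright hx.2 hx.1, hright hx.1 hx.2, hleft hx.2 hx.1]

theorem isSubcontinuum_closure_gap [CompactSpace W] (h : NestedCuts m A M N B M' N')
    (hW : IsThick W m) (hm : 2 ≤ m) (hwheel : ¬ IsFiniteWheel m (A ∪ B)) :
    IsSubcontinuum (closure (gap M N')) := by
  refine ⟨isClosed_closure.isCompact, (h.gap_nonempty hW hm).closure, ?_⟩
  rw [← h.closure_region_diff hW hm]
  refine IsPreconnected.closure ?_
  by_contra hcon
  obtain ⟨U, V, hs⟩ := exists_isSplit hcon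
  exact hwheel (h.isFiniteWheel_of_split hW hm hs)

end NestedCuts

end Splits

/-! ### Isolated common points and the separated continuum. -/

section Existence

variable {W : Type*} [TopologicalSpace W] {M' N' M'' N'' A B C M N : Set W} {m : ℕ}

/-- The common points of two min cuts that are isolated in the region between them. -/
def isolatedEnds (A B M N : Set W) : Set W := (A ∩ B) \ closure (gap M N)

namespace NestedCuts

theorem inter_subset_middle (h₁ : NestedCuts m A M N B M' N') (h₂ : NestedCuts m B M' N' C M'' N'')
    :
    A ∩ C ⊆ B := fun _ hx =>
  h₂.dec_left.2.2.2.subset ⟨h₁.left_subset (h₁.dec_left.subset_left hx.1),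
    h₂.right_subset (h₂.dec_right.symm.subset_left hx.2)⟩

/-- Points common to the outer cuts lie in the middle cut, and the wider gap contains the narrower
one, so missing its closure is the stronger condition. -/
theorem isolatedEnds_subset_left (h₁ : NestedCuts m A M N B M' N')
    (h₂ : NestedCuts m B M' N' C M'' N'') :
    isolatedEnds A C M N'' ⊆ isolatedEnds A B M N' := fun _ hx =>
  ⟨⟨hx.1.1, h₁.inter_subset_middle h₂ hx.1⟩, fun hx' => hx.2 (closure_mono
    (compl_subset_compl.2 (union_subset_union_right _ h₂.right_subset)) hx')⟩

theorem isolatedEnds_subset_right (h₁ : NestedCuts m A M N B M' N')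
    (h₂ : NestedCuts m B M' N' C M'' N'') :
    isolatedEnds A C M N'' ⊆ isolatedEnds B C M' N'' := fun _ hx =>
  ⟨⟨h₁.inter_subset_middle h₂ hx.1, hx.1.2⟩, fun hx' => hx.2 (closure_mono
    (compl_subset_compl.2 (union_subset_union_left _ h₁.left_subset)) hx')⟩

theorem inter_subset_singleton (h : NestedCuts 2 A M N B M' N') {x : W} (hx : x ∈ A ∩ B) :
    A ∩ B ⊆ {x} := by
  have h1 := h.inter_ncard_lt
  have hf : (A ∩ B).Finite := h.cut_left.finite.inter_of_left _
  intro y hy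
  exact (ncard_le_one hf).1 (by omega) y hy x hx

variable [T2Space W]

theorem left_diff_isolatedEnds_subset (h : NestedCuts m A M N B M' N') (hW : IsThick W m)
    (hm : 2 ≤ m) : A \ isolatedEnds A B M N' ⊆ closure (gap M N') := by
  rintro x ⟨hxA, hx⟩
  by_cases hxB : x ∈ B
  · by_contra hcon
    exact hx ⟨⟨hxA, hxB⟩, hcon⟩
  · exact h.left_diff_subset_closure hW hm ⟨hxA, hxB⟩

theorem right_diff_isolatedEnds_subset (h : NestedCuts m A M N B M' N') (hW : IsThick W m)
    (hm : 2 ≤ m) : B \ isolatedEnds A B M N' ⊆ closure (gap M N') := by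
  have := h.symm.left_diff_isolatedEnds_subset hW hm
  rwa [isolatedEnds, inter_comm B A, gap_comm] at this

/-- The closures of two consecutive gaps that share two points of the cut between them form a
continuum that the cut separates. -/
theorem separatesInto_closure_gap (h₁ : NestedCuts m A M N B M' N')
    (h₂ : NestedCuts m B M' N' C M'' N'') (hW : IsThick W m) (hm : 2 ≤ m)
    (hc₁ : IsSubcontinuum (closure (gap M N'))) (hc₂ : IsSubcontinuum (closure (gap M' N'')))
    (hcard : (isolatedEnds A B M N' ∪ isolatedEnds B C M' N'').ncard + 2 ≤ m) :
    SeparatesInto B (closure (gap M N') ∪ closure (gap M' N'')) (closure (gap M N'))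
      (closure (gap M' N'')) ∧ 2 ≤ (closure (gap M N') ∩ closure (gap M' N'')).encard := by
  have hsub : isolatedEnds A B M N' ∪ isolatedEnds B C M' N'' ⊆ B :=
    union_subset (fun x hx => hx.1.2) fun x hx => hx.1.1
  have hinter : B \ (isolatedEnds A B M N' ∪ isolatedEnds B C M' N'') ⊆
      closure (gap M N') ∩ closure (gap M' N'') := fun x hx =>
    ⟨h₁.right_diff_isolatedEnds_subset hW hm ⟨hx.1, fun h => hx.2 (Or.inl h)⟩,
      h₂.left_diff_isolatedEnds_subset hW hm ⟨hx.1, fun h => hx.2 (Or.inr h)⟩⟩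
  refine ⟨⟨?_, hc₁, hc₂, rfl, M', N', h₁.dec_right, h₁.closure_gap_subset.trans inter_subset_right,
    h₂.closure_gap_subset.trans inter_subset_left⟩, ?_⟩
  · obtain ⟨x, hx⟩ := h₁.gap_nonempty hW hm
    obtain ⟨y, hy⟩ := h₂.gap_nonempty hW hm
    have hxM : x ∈ M' := (h₁.gap_subset hx).2
    have hyN : y ∈ N' := (h₂.gap_subset hy).1
    have hxB : x ∉ B := fun hB => hx (Or.inr (h₁.dec_right.symm.subset_left hB))
    have hyB : y ∉ B := fun hB => hy (Or.inl (h₂.dec_left.subset_left hB))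
    refine ⟨x, ⟨Or.inl (subset_closure hx), hxB⟩, y, ⟨Or.inr (subset_closure hy), hyB⟩, ?_⟩
    intro heq
    have hyx : y ∈ connectedComponentIn Bᶜ x := heq ▸ mem_connectedComponentIn hyB
    have hcov : connectedComponentIn Bᶜ x ⊆ (M' \ B) ∪ (N' \ B) := by
      intro z hz
      have hzB := connectedComponentIn_subset _ _ hz
      have hz' : z ∈ M' ∪ N' := h₁.dec_right.2.2.1 ▸ mem_univ z
      exact hz'.imp (fun h => ⟨h, hzB⟩) fun h => ⟨h, hzB⟩
    obtain ⟨z, -, hz1, hz2⟩ := isPreconnected_connectedComponentIn _ _ h₁.dec_right.isOpen_diff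
      h₁.dec_right.symm.isOpen_diff hcov ⟨x, mem_connectedComponentIn hxB, hxM, hxB⟩
      ⟨y, hyx, hyN, hyB⟩
    exact hz1.2 (h₁.dec_right.2.2.2 ▸ ⟨hz1.1, hz2.1⟩)
  · refine le_trans ?_ (encard_le_encard hinter)
    rw [← (h₁.cut_right.finite.sdiff).cast_ncard_eq]
    have h3 := ncard_sdiff_add_ncard_of_subset hsub h₁.cut_right.finite
    rw [h₁.cut_right.ncard_eq] at h3
    exact_mod_cast (by omega : 2 ≤ (B \ (isolatedEnds A B M N' ∪ isolatedEnds B C M' N'')).ncard)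

/-- An isolated point is common to both cuts, so `A ∪ B` has at most three points, and the frontier
omits the isolated one. -/
theorem encard_frontier_closure_gap (h : NestedCuts 2 A M N B M' N') (hW : IsThick W 2)
    (hne : (isolatedEnds A B M N').Nonempty) : (frontier (closure (gap M N'))).encard = 2 := by
  have hfin : (A ∪ B).Finite := h.cut_left.finite.union h.cut_right.finite
  have hfr := hfin.sdiff.subset h.frontier_closure_gap_subset
  have h1 := hW.le_ncard_of_frontier_subset hfr
    isClosed_closure Subset.rfl (h.interior_closure_gap_nonempty hW le_rfl)
    (h.compl_closure_gap_nonempty le_rfl)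
  have h2 := ncard_le_ncard h.frontier_closure_gap_subset hfin.sdiff
  have hsub : isolatedEnds A B M N' ⊆ A ∪ B := fun x hx => Or.inl hx.1.1
  have h3 := ncard_sdiff_add_ncard_of_subset hsub hfin
  have h4 := h.ncard_union_inter
  have h5 : (isolatedEnds A B M N').ncard ≤ (A ∩ B).ncard :=
    ncard_le_ncard sdiff_subset (h.cut_left.finite.inter_of_left _)
  have h6 := (ncard_pos (hfin.subset hsub)).2 hne
  rw [isolatedEnds] at *
  rw [← hfr.cast_ncard_eq]
  exact_mod_cast (by omega : (frontier (closure (gap M N'))).ncard = 2)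

/-- Three consecutive two-point cuts with a common isolated point lie in a wheel. -/
theorem isFiniteWheel_of_isolated [CompactSpace W] (h₁ : NestedCuts 2 A M N B M' N')
    (h₂ : NestedCuts 2 B M' N' C M'' N'') (hAC : A ≠ C) (hW : IsThick W 2)
    (hc₁ : IsSubcontinuum (closure (gap M N'))) (hc₂ : IsSubcontinuum (closure (gap M' N'')))
    (hne : (isolatedEnds A C M N'').Nonempty) : IsFiniteWheel 2 (A ∪ B ∪ C) := by
  obtain ⟨x, hx⟩ := hne
  have h₃ : NestedCuts 2 A M N C M'' N'' := ⟨h₁.cut_left, h₂.cut_right, hAC, h₁.dec_left,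
    h₂.dec_right, h₁.left_subset.trans h₂.left_subset, h₂.right_subset.trans h₁.right_subset⟩
  have hx₁ := h₁.isolatedEnds_subset_left h₂ hx
  have hx₂ := h₁.isolatedEnds_subset_right h₂ hx
  have hnt : ∀ {Z : Set W}, (frontier (closure Z)).encard = 2 → (closure Z).Nontrivial := by
    intro Z hZ
    have : (frontier (closure Z)).Nontrivial := by
      rw [← one_lt_encard_iff_nontrivial, hZ]; norm_num
    exact this.mono (by rw [isClosed_closure.frontier_eq]; exact sdiff_subset)
  have hf₁ := h₁.encard_frontier_closure_gap hW ⟨x, hx₁⟩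
  have hf₂ := h₂.encard_frontier_closure_gap hW ⟨x, hx₂⟩
  have s₁ := h₁.closure_gap_subset
  have s₂ := h₂.closure_gap_subset
  have hMC : M ∩ N'' = A ∩ C := h₃.inter_eq
  have hA : M ∩ N = A := h₁.dec_left.2.2.2
  have hB : M' ∩ N' = B := h₁.dec_right.2.2.2
  have hC : M'' ∩ N'' = C := h₂.dec_right.2.2.2
  -- The isolated point `x` closes the cycle: it lies in both outer sides. It is the only common
  -- point of consecutive cuts and misses both gap closures, so opposite pieces are disjoint.
  refine isFiniteWheel_of_four (I := ∅) (Y₀ := M) (Y₁ := closure (gap M N'))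
    (Y₂ := closure (gap M' N'')) (Y₃ := N'')
    ((h₁.cut_left.finite.union h₁.cut_right.finite).union h₂.cut_right.finite)
    ⟨h₁.dec_left.1, h₁.dec_left.nontrivial_left le_rfl h₁.cut_left⟩ ⟨hc₁, hnt hf₁⟩ ⟨hc₂, hnt hf₂⟩
    ⟨h₂.dec_right.2.1, h₂.dec_right.symm.nontrivial_left le_rfl h₂.cut_right⟩ ?_ ?_ ?_
    (by simp) ?_ (by rw [h₁.dec_left.frontier_left hW le_rfl h₁.cut_left, h₁.cut_left.1])
    hf₁ hf₂ (by rw [h₂.dec_right.symm.frontier_left hW le_rfl h₂.cut_right, h₂.cut_right.1])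
  · intro y
    rcases mem_or_mem_gap_or_mem M N' y with h | h | h
    · exact Or.inl h
    · exact Or.inr (Or.inl (subset_closure h))
    · rcases mem_or_mem_gap_or_mem M' N'' y with h' | h' | h'
      · by_cases hy : y ∈ isolatedEnds A B M N'
        · exact Or.inl (h₁.dec_left.subset_left hy.1.1)
        · exact Or.inr (Or.inl (h₁.right_diff_isolatedEnds_subset hW le_rfl
            ⟨hB.subset ⟨h', h⟩, hy⟩))
      · exact Or.inr (Or.inr (Or.inl (subset_closure h')))
      · exact Or.inr (Or.inr (Or.inr h'))
  · rw [← subset_empty_iff]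
    rintro y ⟨hyM, hy⟩
    have h1 : y ∈ M ∩ N' := ⟨hyM, (s₂ hy).1⟩
    rw [h₁.inter_eq] at h1
    obtain rfl := h₁.inter_subset_singleton hx₁.1 h1
    exact hx₂.2 hy
  · rw [← subset_empty_iff]
    rintro y ⟨hy, hyN⟩
    have h1 : y ∈ M' ∩ N'' := ⟨(s₁ hy).2, hyN⟩
    rw [h₂.inter_eq] at h1
    obtain rfl := h₂.inter_subset_singleton hx₂.1 h1
    exact hx₁.2 hy
  · apply Subset.antisymm
    · have hxN : x ∈ N'' ∩ M := (inter_comm M N'' ▸ hMC.symm.subset hx.1 : x ∈ N'' ∩ M)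
      rintro y ((hy | hy) | hy)
      · by_cases h : y ∈ isolatedEnds A B M N'
        · obtain rfl := h₁.inter_subset_singleton hx₁.1 h.1
          exact Or.inr (Or.inr hxN)
        · exact Or.inl (Or.inl ⟨h₁.dec_left.subset_left hy,
            h₁.left_diff_isolatedEnds_subset hW le_rfl ⟨hy, h⟩⟩)
      · by_cases h : y ∈ isolatedEnds A B M N'
        · obtain rfl := h₁.inter_subset_singleton hx₁.1 h.1
          exact Or.inr (Or.inr hxN)
        · by_cases h' : y ∈ isolatedEnds B C M' N''
          · obtain rfl := h₂.inter_subset_singleton hx₂.1 h'.1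
            exact Or.inr (Or.inr hxN)
          · exact Or.inl (Or.inr ⟨h₁.right_diff_isolatedEnds_subset hW le_rfl ⟨hy, h⟩,
              h₂.left_diff_isolatedEnds_subset hW le_rfl ⟨hy, h'⟩⟩)
      · by_cases h : y ∈ isolatedEnds B C M' N''
        · obtain rfl := h₂.inter_subset_singleton hx₂.1 h.1
          exact Or.inr (Or.inr hxN)
        · exact Or.inr (Or.inl ⟨h₂.right_diff_isolatedEnds_subset hW le_rfl ⟨hy, h⟩,
            h₂.dec_right.symm.subset_left hy⟩)
    · rintro y ((hy | hy) | (hy | hy))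
      · exact Or.inl (Or.inl (hA.subset ⟨hy.1, (s₁ hy.2).1⟩))
      · exact Or.inl (Or.inr (hB.subset ⟨(s₁ hy.1).2, (s₂ hy.2).1⟩))
      · exact Or.inr (hC.subset ⟨(s₂ hy.1).2, hy.2⟩)
      · exact Or.inl (Or.inl (hMC.subset ⟨hy.2, hy.1⟩).1)

end NestedCuts

variable [T2Space W]

theorem IsDecomposition.union_subset_or (hW : IsThick W m) (hm : 2 ≤ m)
    (hA : IsMinCut m A) (hB : IsMinCut m B) (hAB : A ≠ B) (h : IsDecomposition A M N)
    (hBN : B ⊆ N) (h' : IsDecomposition B M' N') {S : Set W} (hS : S ⊆ M) :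
    S ⊆ M' ∨ S ⊆ N' :=
  (h.subset_or_subset hW hm hA hB hAB hBN h').imp hS.trans hS.trans

/-- Linearly ordered min cuts have nested decompositions. -/
theorem exists_nestedCuts (hW : IsThick W m) (hm : 2 ≤ m) {A : Fin 8 → Set W}
    (hA : ∀ i, IsMinCut m (A i)) (hlin : LinearlyOrderedCuts A) :
    ∃ M N : Fin 8 → Set W,
      (∀ i, 0 < i → i < 7 → IsDecomposition (A i) (M i) (N i) ∧ A 0 ⊆ M i ∧ A 7 ⊆ N i) ∧
      ∀ i j, 0 < i → i < j → j < 7 → NestedCuts m (A i) (M i) (N i) (A j) (M j) (N j) := by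
  have hex : ∀ i : Fin 8, ∃ M N, 0 < i → i < 7 → IsDecomposition (A i) M N ∧ A 0 ⊆ M ∧ A 7 ⊆ N := by
    intro i
    by_cases h : 0 < i ∧ i < 7
    · obtain ⟨M, N, h1⟩ := hlin.2 0 i 7 h.1 h.2
      exact ⟨M, N, fun _ _ => h1⟩
    · exact ⟨∅, ∅, fun h1 h2 => absurd ⟨h1, h2⟩ h⟩
  choose M N hMN using hex
  refine ⟨M, N, hMN, fun i j hi hij hj => ?_⟩
  have hne : ∀ {i j : Fin 8}, i < j → A i ≠ A j := fun h heq => h.ne (hlin.1 heq)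
  obtain ⟨di, hi0, hi7⟩ := hMN i hi (hij.trans hj)
  obtain ⟨dj, hj0, hj7⟩ := hMN j (hi.trans hij) hj
  -- The decomposition of `A i` given by betweenness with `A j` need not be `M i`, `N i`. Its side
  -- through `A 0` does not cross `A j`, and `A 0` identifies that side as lying in `M j`.
  have h1 : A i ⊆ M j := by
    obtain ⟨P, P', hP, h0, hjP⟩ := hlin.2 0 i j hi hij
    exact hP.subset_left.trans (hP.subset_of_cut_subset hW hm (hA i) (hA j) (hne hij) hjP dj
      (hA 0) (hne (hi.trans hij)) h0 hj0)
  have h2 : A j ⊆ N i := by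
    obtain ⟨P, P', hP, hiP, h7⟩ := hlin.2 i j 7 hij hj
    exact hP.symm.subset_left.trans (hP.symm.subset_of_cut_subset hW hm (hA j) (hA i)
      (hne hij).symm hiP di.symm (hA 7) (hne (hij.trans hj)).symm h7 hi7)
  exact ⟨hA i, hA j, hne hij, di, dj,
    di.subset_of_cut_subset hW hm (hA i) (hA j) (hne hij) h2 dj (hA 0) (hne (hi.trans hij)) hi0 hj0,
    dj.symm.subset_of_cut_subset hW hm (hA j) (hA i) (hne hij).symm h1 di.symm (hA 7)
      (hne (hij.trans hj)).symm hj7 hi7⟩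

theorem exists_separated_continuum [CompactSpace W] (hm : 2 ≤ m) (hW : IsThick W m)
    (A : Fin 8 → Set W) (hA : ∀ i, IsMinCut m (A i)) (hlin : LinearlyOrderedCuts A)
    (hwheel : ∀ i j, i ≠ j → ¬ ∃ F : Set W, IsWheel m F ∧ A i ⊆ F ∧ A j ⊆ F) :
    ∃ (i : Fin 8) (Q Q₁ Q₂ : Set W), SetBetween (A 0) (A 7) Q ∧
      SeparatesInto (A i) Q Q₁ Q₂ ∧ 2 ≤ (Q₁ ∩ Q₂).encard := by
  obtain ⟨M, N, hdec, hnest⟩ := exists_nestedCuts hW hm hA hlin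
  have hcont : ∀ i j, 0 < i → i < j → j < 7 → IsSubcontinuum (closure (gap (M i) (N j))) := by
    intro i j hi hij hj
    refine (hnest i j hi hij hj).isSubcontinuum_closure_gap hW hm fun hF => ?_
    exact hwheel i j hij.ne ⟨_, Or.inl hF, subset_union_left, subset_union_right⟩
  have hbetween : ∀ i j, 0 < i → i < j → j < 7 → ∀ Q ⊆ N i ∩ M j, SetBetween (A 0) (A 7) Q := by
    intro i j hi hij hj Q hQ
    obtain ⟨di, hi0, hi7⟩ := hdec i hi (hij.trans hj)
    obtain ⟨dj, hj0, hj7⟩ := hdec j (hi.trans hij) hj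
    refine ⟨fun P P' hP => ?_, fun P P' hP => ?_⟩
    · exact di.symm.union_subset_or hW hm (hA i) (hA 0) (fun h => hi.ne' (hlin.1 h)) hi0 hP
        (union_subset hi7 (hQ.trans inter_subset_left))
    · exact dj.union_subset_or hW hm (hA j) (hA 7) (fun h => hj.ne (hlin.1 h)) hj7 hP
        (union_subset hj0 (hQ.trans inter_subset_right))
  by_contra hcon
  set D : Fin 8 → Fin 8 → Set W := fun i j => isolatedEnds (A i) (A j) (M i) (N j) with hD
  have hDfin : ∀ i j, (D i j).Finite := fun i j =>
    ((hA i).finite.inter_of_left _).sdiff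
  have hle : ∀ i j, 0 < i → i < j → j < 7 → 2 * (D i j).ncard ≤ m := fun i j hi hij hj =>
    (hnest i j hi hij hj).two_mul_ncard_isolated_le hW hm
  have hge : ∀ i j l, 0 < i → i < j → j < l → l < 7 → m ≤ (D i j ∪ D j l).ncard + 1 := by
    intro i j l hi hij hjl hl
    by_contra hlt
    have n₁ := hnest i j hi hij (hjl.trans hl)
    have n₂ := hnest j l (hi.trans hij) hjl hl
    have := n₁.separatesInto_closure_gap n₂ hW hm (hcont i j hi hij (hjl.trans hl))
      (hcont j l (hi.trans hij) hjl hl) (by show (D i j ∪ D j l).ncard + 2 ≤ m; omega)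
    refine hcon ⟨j, _, _, _, hbetween i l hi (hij.trans hjl) hl _ ?_, this⟩
    exact union_subset
      (n₁.closure_gap_subset.trans (inter_subset_inter_right _ n₂.left_subset))
      (n₂.closure_gap_subset.trans (inter_subset_inter_left _ n₁.right_subset))
  have hsub : ∀ i j l, 0 < i → i < j → j < l → l < 7 → (D i l).ncard ≤ (D i j ∩ D j l).ncard := by
    intro i j l hi hij hjl hl
    have n₁ := hnest i j hi hij (hjl.trans hl)
    have n₂ := hnest j l (hi.trans hij) hjl hl
    exact ncard_le_ncard (subset_inter (n₁.isolatedEnds_subset_left n₂)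
      (n₁.isolatedEnds_subset_right n₂)) ((hDfin i j).inter_of_left _)
  have hempty : m = 2 → ∀ i j l, 0 < i → i < j → j < l → l < 7 → (D i l).ncard = 0 := by
    rintro rfl i j l hi hij hjl hl
    by_contra hne
    have hne' : (D i l).Nonempty := (ncard_pos (hDfin i l)).1 (Nat.pos_of_ne_zero hne)
    have hF := (hnest i j hi hij (hjl.trans hl)).isFiniteWheel_of_isolated
      (hnest j l (hi.trans hij) hjl hl) (fun h => (hij.trans hjl).ne (hlin.1 h)) hW
      (hcont i j hi hij (hjl.trans hl)) (hcont j l (hi.trans hij) hjl hl) hne'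
    exact hwheel i l (hij.trans hjl).ne ⟨_, Or.inl hF,
      subset_union_left.trans subset_union_left, subset_union_right⟩
  have hunion : ∀ i j k l, (D i j ∪ D k l).ncard + (D i j ∩ D k l).ncard =
      (D i j).ncard + (D k l).ncard := fun i j k l =>
    ncard_union_add_ncard_inter _ _ (hDfin i j) (hDfin k l)
  -- The rest is arithmetic: the triples 1, 2, 3 and 3, 4, 5 make `D 1 3` and `D 3 5` too small for
  -- the triple 1, 3, 5.
  have a1 := hge 1 2 3 (by decide) (by decide) (by decide) (by decide)
  have a2 := hge 3 4 5 (by decide) (by decide) (by decide) (by decide)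
  have a3 := hge 1 3 5 (by decide) (by decide) (by decide) (by decide)
  have b1 := hle 1 2 (by decide) (by decide) (by decide)
  have b2 := hle 2 3 (by decide) (by decide) (by decide)
  have b3 := hle 3 4 (by decide) (by decide) (by decide)
  have b4 := hle 4 5 (by decide) (by decide) (by decide)
  have c1 := hsub 1 2 3 (by decide) (by decide) (by decide) (by decide)
  have c2 := hsub 3 4 5 (by decide) (by decide) (by decide) (by decide)
  have d1 := hunion 1 2 2 3
  have d2 := hunion 3 4 4 5
  have d3 := hunion 1 3 3 5
  have e1 := fun h => hempty h 1 2 3 (by decide) (by decide) (by decide) (by decide)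
  have e2 := fun h => hempty h 3 4 5 (by decide) (by decide) (by decide) (by decide)
  by_cases h2 : m = 2
  · have := e1 h2
    have := e2 h2
    omega
  · omega

end Existence

/-! ### Geodesics, rays and angles in CAT(0) spaces. -/

section CATZeroGeometry

theorem exists_euclidean_triangle {x y z : ℝ} (hx : 0 ≤ x) (hy : 0 ≤ y) (hz : 0 ≤ z)
    (h1 : x ≤ y + z) (h2 : y ≤ x + z) (h3 : z ≤ x + y) :
    ∃ a b c : EuclideanSpace ℝ (Fin 2), dist a b = x ∧ dist a c = y ∧ dist b c = z := by
  rcases hx.eq_or_lt with rfl | hx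
  · obtain rfl : y = z := by linarith
    refine ⟨0, 0, !₂[y, 0], by simp, ?_, ?_⟩ <;>
    · rw [EuclideanSpace.dist_eq]
      simp [Fin.sum_univ_two, Real.dist_eq, Real.sqrt_sq hy]
  -- `u` is the abscissa of the third vertex, by the law of cosines.
  · set u := (x ^ 2 + y ^ 2 - z ^ 2) / (2 * x) with hu
    have hux : 2 * x * u = x ^ 2 + y ^ 2 - z ^ 2 := by rw [hu]; field_simp
    have hu1 : u ≤ y := by
      rw [hu, div_le_iff₀ (by positivity)]; nlinarith
    have hu2 : -y ≤ u := by
      rw [hu, le_div_iff₀ (by positivity)]; nlinarith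
    have hv : 0 ≤ y ^ 2 - u ^ 2 := by nlinarith
    refine ⟨0, !₂[x, 0], !₂[u, √(y ^ 2 - u ^ 2)], ?_, ?_, ?_⟩ <;>
      rw [EuclideanSpace.dist_eq] <;>
      simp only [Fin.sum_univ_two, Real.dist_eq, sq_abs, PiLp.zero_apply,
        Matrix.cons_val_zero, Matrix.cons_val_one, zero_sub, neg_sq, Real.sq_sqrt hv]
    · simp [Real.sqrt_sq hx.le]
    · rw [add_sub_cancel, Real.sqrt_sq hy]
    · rw [show (x - u) ^ 2 + (y ^ 2 - u ^ 2) = z ^ 2 by nlinarith, Real.sqrt_sq hz]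

variable {X : Type*} [MetricSpace X]

theorem IsGeodesicFromTo.reverse {γ : ℝ → X} {x y : X} (h : IsGeodesicFromTo γ x y) :
    IsGeodesicFromTo (fun t => γ (dist x y - t)) y x := by
  refine ⟨by simpa using h.2.1, by simpa [dist_comm y x] using h.1, fun s hs t ht => ?_⟩
  rw [dist_comm y x] at hs ht
  rw [h.2.2 _ ⟨by linarith [hs.2], by linarith [hs.1]⟩ _ ⟨by linarith [ht.2], by linarith [ht.1]⟩,
    abs_sub_comm]
  congr 1
  ring

namespace IsCATZero

/-- Distances between geodesics with a common starting point are convex. -/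
theorem dist_le_mul (hX : IsCATZero X) {a b c : X} {γ δ : ℝ → X} (hγ : IsGeodesicFromTo γ a b)
    (hδ : IsGeodesicFromTo δ a c) {s : ℝ} (hs : s ∈ Icc (0 : ℝ) 1) :
    dist (γ (s * dist a b)) (δ (s * dist a c)) ≤ s * dist b c := by
  obtain ⟨a', b', c', h1, h2, h3⟩ := exists_euclidean_triangle (dist_nonneg (x := a) (y := b))
    (dist_nonneg (x := a) (y := c)) (dist_nonneg (x := b) (y := c))
    (by rw [dist_comm b c]; exact dist_triangle _ _ _) (dist_triangle _ _ _)
    (by rw [dist_comm a b]; exact dist_triangle _ _ _)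
  have hp : ∀ e : EuclideanSpace ℝ (Fin 2), AffineMap.lineMap a' e s ∈ segment ℝ a' e := fun e => by
    rw [segment_eq_image_lineMap]
    exact mem_image_of_mem _ hs
  have hd : ∀ e : EuclideanSpace ℝ (Fin 2), dist a' (AffineMap.lineMap a' e s) = s * dist a' e :=
    fun e => by rw [dist_left_lineMap, Real.norm_of_nonneg hs.1]
  have := hX.comparison a b c γ δ hγ hδ a' b' c' h1 h2 h3 _ (hp b') _ (hp c')
  rw [hd, hd, h1, h2] at this
  refine this.trans_eq ?_
  rw [← h3, dist_eq_norm, dist_eq_norm, AffineMap.lineMap_apply_module,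
    AffineMap.lineMap_apply_module, ← Real.norm_of_nonneg hs.1, ← norm_smul,
    Real.norm_of_nonneg hs.1]
  congr 1
  module

/-- The point that divides the geodesic from `x` to `y` in the ratio `s : 1 - s`. -/
noncomputable def point (hX : IsCATZero X) (x y : X) (s : ℝ) : X :=
  (hX.exists_geodesic x y).choose (s * dist x y)

/-- Uniqueness of geodesics: comparison with a degenerate triangle whose two far vertices coincide.
-/
theorem eq_point (hX : IsCATZero X) {x y : X} {γ : ℝ → X} (hγ : IsGeodesicFromTo γ x y) {s : ℝ}
    (hs : s ∈ Icc (0 : ℝ) 1) : γ (s * dist x y) = hX.point x y s := by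
  have := hX.dist_le_mul hγ (hX.exists_geodesic x y).choose_spec hs
  rw [dist_self, mul_zero] at this
  exact dist_le_zero.1 this

theorem point_zero (hX : IsCATZero X) (x y : X) : hX.point x y 0 = x := by
  rw [point, zero_mul]
  exact (hX.exists_geodesic x y).choose_spec.1

theorem point_one (hX : IsCATZero X) (x y : X) : hX.point x y 1 = y := by
  rw [point, one_mul]
  exact (hX.exists_geodesic x y).choose_spec.2.1

theorem dist_point_point (hX : IsCATZero X) (x y : X) {s t : ℝ} (hs : s ∈ Icc (0 : ℝ) 1)
    (ht : t ∈ Icc (0 : ℝ) 1) : dist (hX.point x y s) (hX.point x y t) = |s - t| * dist x y := by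
  have h0 := dist_nonneg (x := x) (y := y)
  have hmem : ∀ {s : ℝ}, s ∈ Icc (0 : ℝ) 1 → s * dist x y ∈ Icc 0 (dist x y) := fun hs =>
    ⟨mul_nonneg hs.1 h0, mul_le_of_le_one_left h0 hs.2⟩
  rw [point, point, (hX.exists_geodesic x y).choose_spec.2.2 _ (hmem hs) _ (hmem ht), ← sub_mul,
    abs_mul, abs_of_nonneg h0]

theorem dist_point_right_le (hX : IsCATZero X) (x y z : X) {s : ℝ} (hs : s ∈ Icc (0 : ℝ) 1) :
    dist (hX.point x y s) (hX.point x z s) ≤ s * dist y z :=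
  hX.dist_le_mul (hX.exists_geodesic x y).choose_spec (hX.exists_geodesic x z).choose_spec hs

theorem point_comm (hX : IsCATZero X) (x y : X) {s : ℝ} (hs : s ∈ Icc (0 : ℝ) 1) :
    hX.point x y (1 - s) = hX.point y x s := by
  rw [← hX.eq_point (hX.exists_geodesic x y).choose_spec.reverse hs, point, dist_comm y x]
  ring_nf

theorem dist_left_point (hX : IsCATZero X) (x y : X) {s : ℝ} (hs : s ∈ Icc (0 : ℝ) 1) :
    dist x (hX.point x y s) = s * dist x y := by
  have := hX.dist_point_point x y (left_mem_Icc.2 zero_le_one) hs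
  rwa [point_zero, zero_sub, abs_neg, abs_of_nonneg hs.1] at this

theorem continuous_point (hX : IsCATZero X) (x : X) :
    Continuous fun p : X × unitInterval => hX.point x p.1 p.2 := by
  rw [continuous_iff_continuousAt]
  rintro ⟨y, s⟩
  rw [ContinuousAt, tendsto_iff_dist_tendsto_zero]
  have hlim : Tendsto (fun p : X × unitInterval => dist p.1 y + |(p.2 : ℝ) - s| * dist x y)
      (𝓝 (y, s)) (𝓝 0) := by
    have : Continuous fun p : X × unitInterval => dist p.1 y + |(p.2 : ℝ) - s| * dist x y := by
      fun_prop
    simpa using this.tendsto (y, s)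
  refine squeeze_zero (fun _ => dist_nonneg) (fun p => ?_) hlim
  refine (dist_triangle _ (hX.point x y p.2) _).trans (add_le_add ?_ ?_)
  · exact (hX.dist_point_right_le x _ _ p.2.2).trans (mul_le_of_le_one_left dist_nonneg p.2.2.2)
  · exact (hX.dist_point_point x y p.2.2 s.2).le

/-- The radial retraction to the closed ball of radius `t` about `x₀`. -/
noncomputable def retract (hX : IsCATZero X) (x₀ : X) (t : ℝ≥0) (x : X) : X :=
  hX.point x₀ x (t / max (t : ℝ) (dist x₀ x))

theorem ratio_mem (x₀ x : X) (t : ℝ≥0) : t / max (t : ℝ) (dist x₀ x) ∈ Icc (0 : ℝ) 1 :=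
  ⟨div_nonneg t.2 (le_max_of_le_left t.2),
    div_le_one_of_le₀ (le_max_left _ _) (le_max_of_le_left t.2)⟩

theorem continuous_retract (hX : IsCATZero X) (x₀ : X) (t : ℝ≥0) :
    Continuous (hX.retract x₀ t) := by
  rcases eq_or_ne t 0 with rfl | ht
  · have : hX.retract x₀ 0 = fun _ => x₀ := by
      ext x
      simp [retract, point_zero]
    rw [this]
    exact continuous_const
  · have hpos : (0 : ℝ) < t := by positivity
    have : Continuous fun x : X => (x, (⟨_, ratio_mem x₀ x t⟩ : unitInterval)) := by
      refine continuous_id.prodMk (Continuous.subtype_mk ?_ _)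
      refine continuous_const.div (by fun_prop) fun x => ?_
      exact (lt_of_lt_of_le hpos (le_max_left _ _)).ne'
    exact (hX.continuous_point x₀).comp this

theorem dist_retract_le (hX : IsCATZero X) (x₀ : X) (t : ℝ≥0) (x : X) :
    dist (hX.retract x₀ t x) x₀ ≤ t := by
  rw [dist_comm, retract, hX.dist_left_point _ _ (ratio_mem x₀ x t)]
  rcases (le_max_of_le_left t.2 : 0 ≤ max (t : ℝ) (dist x₀ x)).eq_or_lt with h | h
  · rw [← h]; simp
  · rw [div_mul_eq_mul_div, div_le_iff₀ h]
    exact mul_le_mul_of_nonneg_left (le_max_right _ _) t.2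

theorem retract_eq_point (hX : IsCATZero X) {x₀ x : X} {t : ℝ≥0} (ht : t ≤ dist x₀ x) :
    hX.retract x₀ t x = hX.point x₀ x (t / dist x₀ x) := by
  rw [retract, max_eq_right ht]

theorem dist_retract_retract (hX : IsCATZero X) {x₀ x : X} {s t : ℝ≥0} (hs : s ≤ dist x₀ x)
    (ht : t ≤ dist x₀ x) : dist (hX.retract x₀ s x) (hX.retract x₀ t x) = dist s t := by
  have hmem : ∀ {s : ℝ≥0}, s ≤ dist x₀ x → (s : ℝ) / dist x₀ x ∈ Icc (0 : ℝ) 1 := fun {s} hs =>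
    ⟨div_nonneg s.2 dist_nonneg, div_le_one_of_le₀ hs dist_nonneg⟩
  rw [hX.retract_eq_point hs, hX.retract_eq_point ht, hX.dist_point_point _ _ (hmem hs) (hmem ht),
    NNReal.dist_eq]
  rcases (dist_nonneg (x := x₀) (y := x)).eq_or_lt with h | h
  · rw [← h] at hs ht ⊢
    rw [le_antisymm hs s.2, le_antisymm ht t.2]
    simp
  · rw [← sub_div, abs_div, abs_of_pos h, div_mul_cancel₀ _ h.ne']

end IsCATZero

theorem isGeodesicFromTo_ray {α : ℝ≥0 → X} (hα : Isometry α) (T : ℝ≥0) :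
    IsGeodesicFromTo (fun s => α s.toNNReal) (α 0) (α T) := by
  have hd : dist (α 0) (α T) = T := by rw [hα.dist_eq, NNReal.dist_eq]; simp
  refine ⟨by simp, by simp [hd], fun s hs t ht => ?_⟩
  rw [hα.dist_eq, NNReal.dist_eq, Real.coe_toNNReal _ hs.1, Real.coe_toNNReal _ ht.1]

theorem dist_ray_zero {α : ℝ≥0 → X} (hα : Isometry α) (T : ℝ≥0) : dist (α 0) (α T) = T := by
  rw [hα.dist_eq, NNReal.dist_eq]; simp

namespace IsCATZero

theorem ray_eq_point (hX : IsCATZero X) {α : ℝ≥0 → X} (hα : Isometry α) {t T : ℝ≥0} (ht : t ≤ T) :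
    α t = hX.point (α 0) (α T) (t / T) := by
  have hmem : (t : ℝ) / T ∈ Icc (0 : ℝ) 1 := ⟨by positivity, div_le_one_of_le₀ ht T.2⟩
  rw [← hX.eq_point (isGeodesicFromTo_ray hα T) hmem, dist_ray_zero hα]
  rcases eq_or_ne T 0 with rfl | hT
  · rw [le_antisymm ht zero_le]; simp
  · rw [div_mul_cancel₀ _ (by exact_mod_cast hT)]; simp

theorem retract_ray (hX : IsCATZero X) {α : ℝ≥0 → X} (hα : Isometry α) {t T : ℝ≥0} (ht : t ≤ T) :
    hX.retract (α 0) t (α T) = α t := by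
  rw [hX.retract_eq_point (by rw [dist_ray_zero hα]; exact_mod_cast ht), dist_ray_zero hα,
    ← hX.ray_eq_point hα ht]

theorem dist_ray_le (hX : IsCATZero X) {α β : ℝ≥0 → X} (hα : Isometry α) (hβ : Isometry β)
    (h0 : α 0 = β 0) {t T : ℝ≥0} (ht : t ≤ T) :
    dist (α t) (β t) ≤ t / T * dist (α T) (β T) := by
  rw [hX.ray_eq_point hα ht, hX.ray_eq_point hβ ht, h0]
  exact hX.dist_point_right_le _ _ _ ⟨by positivity, div_le_one_of_le₀ ht T.2⟩

/-- By convexity the distance at time `t` is at most `t / T` times the bounded distance at time `T`;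
let `T` tend to infinity. -/
theorem ray_unique (hX : IsCATZero X) {α β : GeodesicRay X} (h0 : α.1 0 = β.1 0)
    (h : raySetoid X α β) : α = β := by
  obtain ⟨C, hC⟩ := h
  refine Subtype.ext (funext fun t => ?_)
  rw [← dist_le_zero]
  have hlim : Tendsto (fun T : ℝ≥0 => (t : ℝ) / T * C) atTop (𝓝 0) := by
    have : Tendsto (fun T : ℝ≥0 => (t : ℝ) / T) atTop (𝓝 0) :=
      tendsto_const_nhds.div_atTop (NNReal.tendsto_coe_atTop.2 tendsto_id)
    simpa using this.mul_const C
  refine ge_of_tendsto hlim ?_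
  filter_upwards [eventually_ge_atTop t] with T hT
  exact (hX.dist_ray_le α.2 β.2 h0 hT).trans (mul_le_mul_of_nonneg_left (hC T) (by positivity))

/-- In a proper CAT(0) space points that tend to infinity subconverge to a ray. -/
theorem exists_ray_limit [ProperSpace X] (hX : IsCATZero X) (x₀ : X) {ι : Type*}
    (U : Ultrafilter ι) {x : ι → X} (hx : Tendsto (fun i => dist x₀ (x i)) U atTop) :
    ∃ α : ℝ≥0 → X, Isometry α ∧ α 0 = x₀ ∧
      ∀ t, Tendsto (fun i => hX.retract x₀ t (x i)) U (𝓝 (α t)) := by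
  -- Limits along an ultrafilter exist in compact balls for all times at once, so no diagonal
  -- subsequence is needed.
  have hex : ∀ t : ℝ≥0, ∃ y, Tendsto (fun i => hX.retract x₀ t (x i)) U (𝓝 y) := by
    intro t
    obtain ⟨y, -, hy⟩ := (isCompact_closedBall x₀ t).ultrafilter_le_nhds
      (U.map fun i => hX.retract x₀ t (x i)) (by
        rw [le_principal_iff]
        exact Filter.mem_map.2 (univ_mem' fun i => hX.dist_retract_le x₀ t (x i)))
    exact ⟨y, hy⟩
  choose α hα using hex
  refine ⟨α, Isometry.of_dist_eq fun s t => ?_, ?_, hα⟩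
  · refine tendsto_nhds_unique ((hα s).dist (hα t)) (tendsto_const_nhds.congr' ?_)
    filter_upwards [hx.eventually_ge_atTop (s : ℝ), hx.eventually_ge_atTop (t : ℝ)] with i hs ht
    exact (hX.dist_retract_retract hs ht).symm
  · refine tendsto_nhds_unique (hα 0) ?_
    simp [retract, point_zero]

theorem exists_ray_from [ProperSpace X] (hX : IsCATZero X) (x₀ : X) (ξ : VisualBoundary X) :
    ∃ α : GeodesicRay X, α.1 0 = x₀ ∧ Quotient.mk (raySetoid X) α = ξ := by
  obtain ⟨β, rfl⟩ := Quotient.exists_rep ξ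
  set C := dist x₀ (β.1 0) with hC
  have hL : ∀ T : ℝ≥0, |dist x₀ (β.1 T) - T| ≤ C := by
    intro T
    have h1 := dist_ray_zero β.2 T
    have h2 := dist_triangle x₀ (β.1 0) (β.1 T)
    have h3 := dist_triangle (β.1 0) x₀ (β.1 T)
    rw [dist_comm (β.1 0) x₀] at h3
    rw [abs_le]
    constructor <;> linarith
  have htend : Tendsto (fun T => dist x₀ (β.1 T)) atTop atTop := by
    refine tendsto_atTop_mono (f := fun T : ℝ≥0 => -C + (T : ℝ)) (fun T => ?_)
      (tendsto_atTop_add_const_left _ _ (NNReal.tendsto_coe_atTop.2 tendsto_id))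
    linarith [(abs_le.1 (hL T)).1]
  obtain ⟨α, hα, h0, hlim⟩ := hX.exists_ray_limit x₀ (Ultrafilter.of atTop)
    (htend.mono_left (Ultrafilter.of_le _))
  refine ⟨⟨α, hα⟩, h0, Quotient.sound ⟨2 * C, fun t => ?_⟩⟩
  refine le_of_tendsto ((hlim t).dist tendsto_const_nhds) ?_
  have hev : ∀ᶠ T : ℝ≥0 in atTop, dist (hX.retract x₀ t (β.1 T)) (β.1 t) ≤ 2 * C := by
    filter_upwards [htend.eventually_ge_atTop (t : ℝ), htend.eventually_gt_atTop 0,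
      eventually_gt_atTop 0] with T hT hpos hT0
    set L := dist x₀ (β.1 T) with hLdef
    have hT0' : (0 : ℝ) < T := by exact_mod_cast hT0
    have hmem : (t : ℝ) / L ∈ Icc (0 : ℝ) 1 := ⟨by positivity, div_le_one_of_le₀ hT hpos.le⟩
    have hmem' : 1 - (t : ℝ) / L ∈ Icc (0 : ℝ) 1 :=
      ⟨by linarith [hmem.2], by linarith [hmem.1]⟩
    -- `u` is the time at which `β` divides its initial segment of length `T` in the ratio in which
    -- time `t` divides the geodesic from `x₀` to `β T`. Convexity seen from `β T` compares these
    -- two points, and `|u - t| ≤ C`.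
    set u : ℝ≥0 := ⟨t / L * T, mul_nonneg hmem.1 T.2⟩ with hu
    have huT : u ≤ T := by
      rw [← NNReal.coe_le_coe]
      exact mul_le_of_le_one_left T.2 hmem.2
    have h1 : hX.retract x₀ t (β.1 T) = hX.point (β.1 T) x₀ (1 - t / L) := by
      rw [hX.retract_eq_point hT, ← hX.point_comm _ _ hmem', sub_sub_cancel]
    have h2 : β.1 u = hX.point (β.1 T) (β.1 0) (1 - t / L) := by
      rw [hX.ray_eq_point β.2 huT, ← hX.point_comm _ _ hmem', sub_sub_cancel]
      congr 1
      show (t : ℝ) / L * T / T = t / L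
      field_simp
    have h3 : dist (hX.retract x₀ t (β.1 T)) (β.1 u) ≤ C := by
      rw [h1, h2]
      exact (hX.dist_point_right_le _ _ _ hmem').trans
        (mul_le_of_le_one_left dist_nonneg hmem'.2)
    have h4 : dist (β.1 u) (β.1 t) ≤ C := by
      rw [β.2.dist_eq, NNReal.dist_eq]
      have : ((u : ℝ≥0) : ℝ) - t = t / L * (T - L) := by
        show (t : ℝ) / L * T - t = t / L * (T - L)
        field_simp
      rw [this, abs_mul, abs_of_nonneg hmem.1, abs_sub_comm]
      exact (mul_le_of_le_one_left (abs_nonneg _) hmem.2).trans (hL T)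
    linarith [dist_triangle (hX.retract x₀ t (β.1 T)) (β.1 u) (β.1 t)]
  exact (Ultrafilter.of_le atTop) hev

theorem rayFrom_spec [ProperSpace X] (hX : IsCATZero X) (x₀ : X) (ξ : VisualBoundary X) :
    ∃ h : Isometry (rayFrom x₀ ξ), rayFrom x₀ ξ 0 = x₀ ∧
      Quotient.mk (raySetoid X) ⟨rayFrom x₀ ξ, h⟩ = ξ := by
  have h := hX.exists_ray_from x₀ ξ
  have heq : rayFrom x₀ ξ = h.choose.1 := dif_pos h
  rw [heq]
  exact ⟨h.choose.2, h.choose_spec⟩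

theorem rayFrom_eq [ProperSpace X] (hX : IsCATZero X) {α : ℝ≥0 → X} (hα : Isometry α) :
    rayFrom (α 0) (Quotient.mk (raySetoid X) ⟨α, hα⟩) = α := by
  obtain ⟨h1, h2, h3⟩ := hX.rayFrom_spec (α 0) (Quotient.mk (raySetoid X) ⟨α, hα⟩)
  exact congrArg Subtype.val (hX.ray_unique (α := ⟨_, h1⟩) (β := ⟨α, hα⟩) h2 (Quotient.exact h3))

theorem dist_rayFrom [ProperSpace X] (hX : IsCATZero X) (x₀ : X) (ξ : VisualBoundary X)
    (t : ℝ≥0) : dist x₀ (rayFrom x₀ ξ t) = t := by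
  obtain ⟨h1, h2, -⟩ := hX.rayFrom_spec x₀ ξ
  have := dist_ray_zero h1 t
  rwa [h2] at this

theorem comparisonAngle_mono [ProperSpace X] (hX : IsCATZero X) (x₀ : X) (ξ η : VisualBoundary X)
    {s t : ℝ≥0} (hs : 0 < s) (hst : s ≤ t) :
    comparisonAngle x₀ (rayFrom x₀ ξ s) (rayFrom x₀ η s) ≤
      comparisonAngle x₀ (rayFrom x₀ ξ t) (rayFrom x₀ η t) := by
  obtain ⟨h1, h2, -⟩ := hX.rayFrom_spec x₀ ξ
  obtain ⟨h3, h4, -⟩ := hX.rayFrom_spec x₀ η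
  have hd := hX.dist_ray_le h1 h3 (h2.trans h4.symm) hst
  have hs' : (0 : ℝ) < s := hs
  have ht' : (0 : ℝ) < t := hs.trans_le hst
  apply Real.arccos_le_arccos
  simp only [hX.dist_rayFrom]
  set a := dist (rayFrom x₀ ξ s) (rayFrom x₀ η s)
  set b := dist (rayFrom x₀ ξ t) (rayFrom x₀ η t)
  have ha : 0 ≤ a := dist_nonneg
  have hab : t * a ≤ s * b := by
    calc t * a ≤ t * (s / t * b) := by gcongr
      _ = s * b := by field_simp
  have hsq : (t * a) ^ 2 ≤ (s * b) ^ 2 := by gcongr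
  rw [div_le_div_iff₀ (by positivity) (by positivity)]
  nlinarith

/-- The comparison angles are bounded by their limit, the angle at infinity. -/
theorem comparisonAngle_le_boundaryAngle [ProperSpace X] (hX : IsCATZero X) (x₀ : X)
    (ξ η : VisualBoundary X) {t : ℝ≥0} (ht : 0 < t) :
    comparisonAngle x₀ (rayFrom x₀ ξ t) (rayFrom x₀ η t) ≤ boundaryAngle x₀ ξ η := by
  set f : ℝ≥0 → ℝ := fun t => comparisonAngle x₀ (rayFrom x₀ ξ t) (rayFrom x₀ η t) with hf
  -- At time 0 the quotient is `0 / 0 = 0` and the comparison angle has the junk value `π / 2`.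
  -- Monotonicity holds only for positive times, hence `max s t`.
  have hmono : Monotone fun s => f (max s t) := fun a b hab =>
    hX.comparisonAngle_mono x₀ ξ η (lt_max_of_lt_right ht) (max_le_max_right t hab)
  have hbdd : BddAbove (range fun s => f (max s t)) :=
    ⟨Real.pi, by rintro _ ⟨s, rfl⟩; exact Real.arccos_le_pi _⟩
  have hlim := tendsto_atTop_ciSup hmono hbdd
  have hlim' : Tendsto f atTop (𝓝 (⨆ s, f (max s t))) := by
    refine hlim.congr' ?_
    filter_upwards [eventually_ge_atTop t] with s hs
    rw [max_eq_left hs]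
  have : boundaryAngle x₀ ξ η = ⨆ s, f (max s t) := hlim'.limUnder_eq
  rw [this]
  exact (le_of_eq (by simp [hf])).trans (le_ciSup hbdd t)

end IsCATZero

end CATZeroGeometry

/-! ### Continuous logarithms and an essential circle map. -/

section Logarithms

/-- `f` has a continuous logarithm. -/
def HasLog {K : Type*} [TopologicalSpace K] (f : K → ℂ) : Prop :=
  ∃ g : K → ℂ, Continuous g ∧ ∀ x, Complex.exp (g x) = f x

/-- The quotient `g / f` stays in the open unit disc about 1, where the principal logarithm is
continuous. -/
theorem hasLog_iff_of_close {K : Type*} [TopologicalSpace K] {f g : K → ℂ} (hf : Continuous f)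
    (hg : Continuous g) (h : ∀ x, ‖g x - f x‖ < ‖f x‖) : HasLog f ↔ HasLog g := by
  have hf0 : ∀ x, f x ≠ 0 := fun x => norm_pos_iff.1 ((norm_nonneg _).trans_lt (h x))
  have hslit : ∀ x, g x / f x ∈ Complex.slitPlane := fun x => by
    have : g x / f x = 1 + (g x - f x) / f x := by field_simp [hf0 x]; ring
    rw [this]
    apply Complex.mem_slitPlane_of_norm_lt_one
    rw [norm_div, div_lt_one (norm_pos_iff.2 (hf0 x))]
    exact h x
  have hlog : Continuous fun x => Complex.log (g x / f x) := (hg.div hf hf0).clog hslit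
  have hexp : ∀ x, Complex.exp (Complex.log (g x / f x)) = g x / f x := fun x =>
    Complex.exp_log (Complex.slitPlane_ne_zero (hslit x))
  constructor
  · rintro ⟨l, hl, hle⟩
    refine ⟨fun x => l x + Complex.log (g x / f x), hl.add hlog, fun x => ?_⟩
    rw [Complex.exp_add, hexp, hle, mul_div_cancel₀ _ (hf0 x)]
  · rintro ⟨l, hl, hle⟩
    refine ⟨fun x => l x - Complex.log (g x / f x), hl.sub hlog, fun x => ?_⟩
    have hg0 : g x ≠ 0 := hle x ▸ Complex.exp_ne_zero _
    rw [Complex.exp_sub, hexp, hle, div_div_cancel₀ hg0]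

/-- By compactness nearby time slices are uniformly close, so having a logarithm is locally constant
in the time parameter. -/
theorem HasLog.of_homotopy {K : Type*} [TopologicalSpace K] [CompactSpace K]
    {H : K × unitInterval → ℂ} (hH : Continuous H) (h0 : ∀ p, H p ≠ 0)
    (h : HasLog fun x => H (x, 0)) : HasLog fun x => H (x, 1) := by
  have hloc : IsLocallyConstant fun s : unitInterval => HasLog fun x => H (x, s) := by
    rw [IsLocallyConstant.iff_eventually_eq]
    intro s
    have hopen : ∀ x ∈ (univ : Set K), ∀ᶠ p : unitInterval × K in 𝓝 s ×ˢ 𝓝 x,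
        ‖H (p.2, p.1) - H (p.2, s)‖ < ‖H (p.2, s)‖ := by
      intro x _
      rw [← nhds_prod_eq]
      refine ContinuousAt.eventually_lt
          (f := fun p : unitInterval × K => ‖H (p.2, p.1) - H (p.2, s)‖)
        (g := fun p : unitInterval × K => ‖H (p.2, s)‖) ?_ ?_ ?_
      · exact Continuous.continuousAt (by fun_prop)
      · exact Continuous.continuousAt (by fun_prop)
      · simpa using h0 (x, s)
    have := isCompact_univ.eventually_forall_of_forall_eventually (x₀ := s)
      (P := fun t x => ‖H (x, t) - H (x, s)‖ < ‖H (x, s)‖) (fun x hx => by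
        have := hopen x hx; rwa [← nhds_prod_eq] at this)
    filter_upwards [this] with t ht
    exact propext (hasLog_iff_of_close (by fun_prop) (by fun_prop) fun x => ht x (mem_univ x)).symm
  have := hloc.apply_eq_of_preconnectedSpace 0 1
  exact this.mp h

theorem IsPreconnected.eq_of_forall_int {W : Type*} [TopologicalSpace W] {S : Set W}
    (hS : IsPreconnected S) {f : W → ℝ} (hf : ContinuousOn f S) (hInt : ∀ x ∈ S, ∃ n : ℤ, f x = n)
    {x y : W} (hx : x ∈ S) (hy : y ∈ S) : f x = f y := by
  have hdisc : IsDiscrete (range ((↑) : ℤ → ℝ)) := Int.isClosedEmbedding_coe_real.isDiscrete_range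
  obtain ⟨c, -, hc⟩ := hS.eqOn_const_of_mapsTo hdisc hf
    (fun z hz => (hInt z hz).imp fun _ h => h.symm) (range_nonempty _)
  exact (hc hx).trans (hc hy).symm

/-- A union of two connected sets on the two sides of a decomposition that share two points
carries an essential map to the circle that extends to the whole space. -/
theorem exists_circle_map {W : Type*} [TopologicalSpace W] [CompactSpace W] [T2Space W]
    {A M N Q₁ Q₂ : Set W} (hA : A.Finite) (h : IsDecomposition A M N) (hQ₁ : IsPreconnected Q₁)
    (hQ₂ : IsPreconnected Q₂) (h₁ : Q₁ ⊆ M) (h₂ : Q₂ ⊆ N) (hcard : (Q₁ ∩ Q₂).Nontrivial) :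
    ∃ f : C(W, ℂ), (∀ x, ‖f x‖ = 1) ∧ ¬ HasLog fun x : ↥(Q₁ ∪ Q₂) => f x := by
  classical
  obtain ⟨p, hp, q, hq, hpq⟩ := hcard
  have hsub : Q₁ ∩ Q₂ ⊆ A := fun x hx => h.2.2.2 ▸ ⟨h₁ hx.1, h₂ hx.2⟩
  obtain ⟨u, hu0, hu1, -⟩ := exists_continuous_zero_one_of_isClosed (isClosed_singleton (x := p))
    (hA.sdiff (t := {p})).isClosed disjoint_sdiff_right
  have hup : u p = 0 := hu0 rfl
  have hu : ∀ x ∈ A, x ≠ p → u x = 1 := fun x hx hxp => hu1 ⟨hx, hxp⟩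
  -- `e` and `e'` run along opposite half circles from 1 at `p` to -1 on the rest of `A`, so they
  -- agree on `A` and glue.
  set e : W → ℂ := fun x => Complex.exp ((Real.pi * u x : ℝ) * Complex.I) with he
  set e' : W → ℂ := fun x => Complex.exp ((-(Real.pi * u x) : ℝ) * Complex.I) with he'
  have hee : ∀ x ∈ A, e x = e' x := by
    intro x hx
    by_cases hxp : x = p
    · simp [he, he', hxp, hup]
    · simp [he, he', hu x hx hxp, Complex.exp_neg, Complex.exp_pi_mul_I]
  have hcont : Continuous fun x => if x ∈ M then e x else e' x := by
    refine Continuous.if (fun x hx => hee x ?_) (by fun_prop) (by fun_prop)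
    rw [← h.2.2.2]
    have hfr : frontier M ⊆ M ∩ N := by
      rw [frontier_eq_closure_inter_closure, h.isClosed_left.closure_eq]
      refine inter_subset_inter_right _ (closure_minimal ?_ h.isClosed_right)
      rw [h.compl_left]
      exact sdiff_subset
    exact hfr hx
  refine ⟨⟨_, hcont⟩, fun x => ?_, ?_⟩
  · show ‖if x ∈ M then e x else e' x‖ = 1
    split_ifs <;> exact Complex.norm_exp_ofReal_mul_I _
  · rintro ⟨g, hg, hge⟩
    change ∀ x : ↥(Q₁ ∪ Q₂), _ = if (x : W) ∈ M then e x else e' x at hge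
    have hInt : ∀ {z : ℂ} {t : ℝ}, Complex.exp z = Complex.exp (t * Complex.I) →
        ∃ n : ℤ, (z.im - t) / (2 * Real.pi) = n := by
      intro z t hz
      obtain ⟨n, hn⟩ := Complex.exp_eq_exp_iff_exists_int.1 hz
      refine ⟨n, ?_⟩
      have him := congrArg Complex.im hn
      simp at him
      rw [him]
      field_simp
      ring
    have hQ₁' : IsPreconnected ((↑) ⁻¹' Q₁ : Set ↥(Q₁ ∪ Q₂)) :=
      IsInducing.subtypeVal.isPreconnected_image.1 (by
        rwa [Subtype.image_preimage_coe, inter_eq_right.2 subset_union_left])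
    have hQ₂' : IsPreconnected ((↑) ⁻¹' Q₂ : Set ↥(Q₁ ∪ Q₂)) :=
      IsInducing.subtypeVal.isPreconnected_image.1 (by
        rwa [Subtype.image_preimage_coe, inter_eq_right.2 subset_union_right])
    set p' : ↥(Q₁ ∪ Q₂) := ⟨p, Or.inl hp.1⟩
    set q' : ↥(Q₁ ∪ Q₂) := ⟨q, Or.inl hq.1⟩
    have huq : u q = 1 := hu q (hsub hq) hpq.symm
    -- From `p` to `q` the imaginary part of a logarithm would grow by `π` along `Q₁` and by `-π`
    -- along `Q₂`.
    have e1 := hQ₁'.eq_of_forall_int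
      (f := fun x : ↥(Q₁ ∪ Q₂) => ((g x).im - Real.pi * u x) / (2 * Real.pi))
      (Continuous.continuousOn (by fun_prop)) (fun x hx => hInt (by
        rw [hge, if_pos (h₁ hx)])) (x := p') (y := q') hp.1 hq.1
    have e2 := hQ₂'.eq_of_forall_int
      (f := fun x : ↥(Q₁ ∪ Q₂) => ((g x).im - -(Real.pi * u x)) / (2 * Real.pi))
      (Continuous.continuousOn (by fun_prop)) (fun x hx => hInt (by
        rw [hge]
        split_ifs with hM
        · exact hee x (h.2.2.2 ▸ ⟨hM, h₂ hx⟩)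
        · rfl)) (x := p') (y := q') hp.2 hq.2
    have hpi := Real.pi_pos
    rw [div_left_inj' (by positivity)] at e1 e2
    change (g p').im - Real.pi * u p = (g q').im - Real.pi * u q at e1
    change (g p').im - -(Real.pi * u p) = (g q').im - -(Real.pi * u q) at e2
    rw [hup, huq] at e1 e2
    linarith

end Logarithms

/-! ### Contracting sets of small Tits radius. -/

section TitsRadius

variable {X : Type*} [MetricSpace X]

theorem boundaryAngle_le_titsDist (x₀ : X) (ξ η : VisualBoundary X) :
    ENNReal.ofReal (boundaryAngle x₀ ξ η) ≤ titsDist x₀ ξ η := by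
  refine le_iInf₂ fun γ hγ => ?_
  -- The trivial subdivision 0, 1, continued constantly.
  have hu : Monotone (fun n : ℕ => if n = 0 then (0 : ℝ) else 1) ∧
      ∀ i : ℕ, (if i = 0 then (0 : ℝ) else 1) ∈ Icc (0 : ℝ) 1 := by
    refine ⟨fun a b hab => ?_, fun i => ?_⟩
    · show (if a = 0 then (0 : ℝ) else 1) ≤ if b = 0 then (0 : ℝ) else 1
      split_ifs with h1 h2 h2
      · exact le_rfl
      · exact zero_le_one
      · omega
      · exact le_rfl
    · split_ifs <;> simp
  have := le_iSup₂ (f := fun (n : ℕ) (u : {u : ℕ → ℝ // Monotone u ∧ ∀ i, u i ∈ Icc (0 : ℝ) 1}) =>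
    ∑ i ∈ Finset.range n, ENNReal.ofReal (boundaryAngle x₀ (γ (u.1 i)) (γ (u.1 (i + 1))))) 1 ⟨_, hu⟩
  refine le_trans (le_of_eq ?_) this
  simp [hγ.1, hγ.2.1]

theorem continuous_rayFrom_apply (x₀ : X) (t : ℝ≥0) :
    @Continuous _ _ (visualTopology x₀) _ fun ξ : VisualBoundary X => rayFrom x₀ ξ t := by
  let := visualTopology x₀
  rw [continuous_iff_continuousAt]
  intro ξ
  rw [ContinuousAt, Metric.tendsto_nhds]
  intro ε hε
  have hopen : IsOpen {η : VisualBoundary X | dist (rayFrom x₀ ξ t) (rayFrom x₀ η t) < ε} :=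
    TopologicalSpace.isOpen_generateFrom_of_mem ⟨ξ, t, ε, hε, rfl⟩
  filter_upwards [hopen.mem_nhds (by simpa using hε : ξ ∈ _)] with η hη
  rw [dist_comm]
  exact hη

namespace IsCATZero

/-- If the angle of two rays is at most `r`, then the geodesic between their points at time `T`
keeps a distance proportional to `T` from the base point. -/
theorem le_dist_point [ProperSpace X] (hX : IsCATZero X) (x₀ : X) (ξ η : VisualBoundary X)
    {r : ℝ} (hr : r ≤ Real.pi) (hle : boundaryAngle x₀ ξ η ≤ r) {T : ℝ≥0} (hT : 0 < T) {s : ℝ}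
    (hs : s ∈ Icc (0 : ℝ) 1) :
    (1 - √((1 - Real.cos r) / 2)) * T ≤
      dist x₀ (hX.point (rayFrom x₀ ξ T) (rayFrom x₀ η T) s) := by
  have hT' : (0 : ℝ) < T := hT
  set a := rayFrom x₀ ξ T with ha
  set b := rayFrom x₀ η T with hb
  have hxa : dist x₀ a = T := hX.dist_rayFrom x₀ ξ T
  have hxb : dist x₀ b = T := hX.dist_rayFrom x₀ η T
  have hang := (hX.comparisonAngle_le_boundaryAngle x₀ ξ η hT).trans hle
  rw [comparisonAngle, ← ha, ← hb, hxa, hxb] at hang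
  have hab : dist a b ≤ 2 * T := by
    have := dist_triangle a x₀ b
    rw [dist_comm a x₀] at this
    linarith
  have hab0 : 0 ≤ dist a b := dist_nonneg
  have hcos := Real.cos_le_cos_of_nonneg_of_le_pi (Real.arccos_nonneg _) hr hang
  rw [Real.cos_arccos (by rw [le_div_iff₀ (by positivity)]; nlinarith)
    (by rw [div_le_one (by positivity)]; nlinarith), le_div_iff₀ (by positivity)] at hcos
  have hcos1 := Real.cos_le_one r
  -- The square root is `sin (r / 2)`, so this bounds the chord by that of a Euclidean angle `r`.
  -- Averaging the triangle inequalities through `a` and `b` then costs only half the chord.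
  have hd : dist a b ≤ 2 * T * √((1 - Real.cos r) / 2) := by
    refine (pow_le_pow_iff_left₀ hab0 (by positivity) two_ne_zero).1 ?_
    rw [mul_pow, Real.sq_sqrt (by linarith)]
    nlinarith
  have h1 := hX.dist_left_point a b hs
  have h2 := hX.dist_point_point a b hs (right_mem_Icc.2 zero_le_one)
  rw [hX.point_one, abs_sub_comm, abs_of_nonneg (by linarith [hs.2])] at h2
  have h3 := dist_triangle x₀ (hX.point a b s) a
  have h4 := dist_triangle x₀ (hX.point a b s) b
  rw [dist_comm (hX.point a b s) a, h1, hxa] at h3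
  rw [h2, hxb] at h4
  linarith

/-- The space of all functions `p` on `[0, ∞)` with `p t` in the ball of radius `t`. -/
def BallPaths (x₀ : X) : Type _ := {p : ℝ≥0 → X // ∀ t : ℝ≥0, p t ∈ Metric.closedBall x₀ (t : ℝ)}

instance (x₀ : X) : TopologicalSpace (BallPaths x₀) := instTopologicalSpaceSubtype

instance (x₀ : X) : T2Space (BallPaths x₀) := inferInstanceAs (T2Space (Subtype _))

/-- Tychonoff's theorem. This space serves as an ambient compactification: it receives both `X` and
its boundary, and being compact Hausdorff it allows Tietze extension. -/
instance (x₀ : X) [ProperSpace X] : CompactSpace (BallPaths x₀) :=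
  isCompact_iff_compactSpace.1
      (isCompact_pi_infinite fun t : ℝ≥0 => isCompact_closedBall x₀ (t : ℝ))

theorem tendsto_ballPaths {x₀ : X} {ι : Type*} {l : Filter ι} {p : ι → BallPaths x₀}
    {q : BallPaths x₀} : Tendsto p l (𝓝 q) ↔ ∀ t, Tendsto (fun i => (p i).1 t) l (𝓝 (q.1 t)) :=
  tendsto_subtype_rng.trans tendsto_pi_nhds

/-- A point of `X`, seen as a path that runs along the geodesic from `x₀`. -/
noncomputable def toPath (hX : IsCATZero X) (x₀ x : X) : BallPaths x₀ :=
  ⟨fun t => hX.retract x₀ t x, fun t => hX.dist_retract_le x₀ t x⟩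

theorem continuous_toPath (hX : IsCATZero X) (x₀ : X) : Continuous (hX.toPath x₀) :=
  Continuous.subtype_mk (continuous_pi fun t => hX.continuous_retract x₀ t) _

/-- A boundary point, seen as a path. -/
noncomputable def boundaryPath [ProperSpace X] (hX : IsCATZero X) (x₀ : X) (ξ : VisualBoundary X) :
    BallPaths x₀ :=
  ⟨rayFrom x₀ ξ, fun t => by
    rw [Metric.mem_closedBall, dist_comm, hX.dist_rayFrom]⟩

theorem continuous_boundaryPath [ProperSpace X] (hX : IsCATZero X) (x₀ : X) :
    @Continuous _ _ (visualTopology x₀) _ (hX.boundaryPath x₀) := by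
  let := visualTopology x₀
  exact Continuous.subtype_mk (continuous_pi fun t => continuous_rayFrom_apply x₀ t) _

theorem boundaryPath_injective [ProperSpace X] (hX : IsCATZero X) (x₀ : X) :
    Function.Injective (hX.boundaryPath x₀) := by
  intro ξ η h
  obtain ⟨h1, -, h2⟩ := hX.rayFrom_spec x₀ ξ
  obtain ⟨h3, -, h4⟩ := hX.rayFrom_spec x₀ η
  rw [← h2, ← h4]
  congr 1
  have h5 : rayFrom x₀ ξ = rayFrom x₀ η := congrArg Subtype.val h
  exact Subtype.ext h5

theorem retract_rayFrom [ProperSpace X] (hX : IsCATZero X) (x₀ : X) (ξ : VisualBoundary X)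
    {t T : ℝ≥0} (h : t ≤ T) : hX.retract x₀ t (rayFrom x₀ ξ T) = rayFrom x₀ ξ t := by
  obtain ⟨h1, h2, -⟩ := hX.rayFrom_spec x₀ ξ
  have := hX.retract_ray h1 h
  rwa [h2] at this

theorem exists_boundary_limit [ProperSpace X] (hX : IsCATZero X) (x₀ : X) {ι : Type*}
    (U : Ultrafilter ι) {x : ι → X} (hx : Tendsto (fun i => dist x₀ (x i)) U atTop) :
    ∃ ξ, Tendsto (fun i => hX.toPath x₀ (x i)) U (𝓝 (hX.boundaryPath x₀ ξ)) := by
  obtain ⟨α, hα, rfl, hlim⟩ := hX.exists_ray_limit x₀ U hx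
  refine ⟨Quotient.mk (raySetoid X) ⟨α, hα⟩, tendsto_ballPaths.2 fun t => ?_⟩
  have : (hX.boundaryPath (α 0) (Quotient.mk (raySetoid X) ⟨α, hα⟩)).1 = α := hX.rayFrom_eq hα
  rw [this]
  exact hlim t

/-! ### Extending boundary functions into the space. -/

section Compactification

variable [ProperSpace X] {W : Type*} [TopologicalSpace W] [CompactSpace W] {x₀ : X}
  {h : W ≃ VisualBoundary X} {F : C(BallPaths x₀, ℂ)}

/-- A function that does not vanish on the boundary does not vanish near infinity. -/
theorem eventually_ne_zero (hX : IsCATZero X) (hF : ∀ ξ, F (hX.boundaryPath x₀ ξ) ≠ 0) :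
    ∃ R : ℝ, ∀ x, R ≤ dist x₀ x → F (hX.toPath x₀ x) ≠ 0 := by
  by_contra! hcon
  choose x hx hx0 using fun n : ℕ => hcon n
  obtain ⟨ξ, hξ⟩ := hX.exists_boundary_limit x₀ (Ultrafilter.of atTop)
    (x := x) ((tendsto_atTop_mono hx tendsto_natCast_atTop_atTop).mono_left (Ultrafilter.of_le _))
  have h1 := (F.continuous.tendsto _).comp hξ
  refine hF ξ (tendsto_nhds_unique h1 ?_)
  refine tendsto_const_nhds.congr fun n => (hx0 n).symm

/-- The values along a ray converge to the value at the boundary, uniformly over all rays. -/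
theorem eventually_norm_sub_lt (hX : IsCATZero X)
    (hh : Continuous fun w => hX.boundaryPath x₀ (h w)) :
    ∀ᶠ T : ℝ≥0 in atTop, ∀ w, ‖F (hX.boundaryPath x₀ (h w)) -
      F (hX.toPath x₀ (rayFrom x₀ (h w) T))‖ < 1 := by
  by_contra hcon
  rw [eventually_atTop] at hcon
  push Not at hcon
  choose T hT w hw using fun n : ℕ => hcon n
  set U : Ultrafilter ℕ := Ultrafilter.of atTop
  obtain ⟨v, -, hv⟩ := isCompact_univ.ultrafilter_le_nhds (U.map w) (by simp)
  have hv' : Tendsto w U (𝓝 v) := hv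
  have h1 : Tendsto (fun n => hX.boundaryPath x₀ (h (w n))) U (𝓝 (hX.boundaryPath x₀ (h v))) :=
    (hh.tendsto v).comp hv'
  have h2 : Tendsto (fun n => hX.toPath x₀ (rayFrom x₀ (h (w n)) (T n))) U
      (𝓝 (hX.boundaryPath x₀ (h v))) := by
    -- At each fixed time `t`, retracting the point at time `T n` on the ray returns the ray itself
    -- once `t ≤ T n`.
    refine tendsto_ballPaths.2 fun t => (tendsto_ballPaths.1 h1 t).congr' ?_
    have : ∀ᶠ n : ℕ in atTop, t ≤ T n := by
      filter_upwards [tendsto_natCast_atTop_atTop.eventually_ge_atTop t] with n hn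
      exact hn.trans (hT n)
    filter_upwards [(Ultrafilter.of_le atTop) this] with n hn
    exact (hX.retract_rayFrom x₀ _ hn).symm
  have h3 := (((F.continuous.tendsto _).comp h1).sub ((F.continuous.tendsto _).comp h2)).norm
  rw [sub_self, norm_zero] at h3
  have := ge_of_tendsto h3 (Eventually.of_forall hw)
  linarith

/-- A circle-valued function on the boundary has a logarithm on each compact set of Tits radius
less than `π`. -/
theorem hasLog_of_boundaryAngle_le [T2Space W] (hX : IsCATZero X)
    (hh : @Continuous _ _ _ (visualTopology x₀) h) {f : C(W, ℂ)} (hf : ∀ w, ‖f w‖ = 1)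
    {Q : Set W} (hQ : IsCompact Q) (z : VisualBoundary X) {r : ℝ} (hr0 : 0 ≤ r)
    (hr : r < Real.pi) (hle : ∀ w ∈ Q, boundaryAngle x₀ z (h w) ≤ r) :
    HasLog fun w : Q => f w := by
  have hj : Continuous fun w => hX.boundaryPath x₀ (h w) :=
    @Continuous.comp _ _ _ _ (visualTopology x₀) _ _ _ (hX.continuous_boundaryPath x₀) hh
  have hemb : IsClosedEmbedding fun w => hX.boundaryPath x₀ (h w) :=
    hj.isClosedEmbedding ((hX.boundaryPath_injective x₀).comp h.injective)
  -- Tietze extension. `F` may vanish, but only at points of `X` within bounded distance of `x₀`, as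
  -- the next step shows for the image of `X`.
  obtain ⟨F, hF⟩ := ContinuousMap.exists_extension' hemb f
  have hF' : ∀ w, F (hX.boundaryPath x₀ (h w)) = f w := fun w => congrFun hF w
  obtain ⟨R, hR⟩ := hX.eventually_ne_zero (F := F) (x₀ := x₀) fun ξ => by
    rw [← h.apply_symm_apply ξ, hF', ← norm_pos_iff, hf]
    exact one_pos
  have hκ : 0 < 1 - √((1 - Real.cos r) / 2) := by
    have : -1 < Real.cos r := by
      rw [← Real.cos_pi]
      exact Real.cos_lt_cos_of_nonneg_of_le_pi hr0 le_rfl hr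
    have : √((1 - Real.cos r) / 2) < 1 := by
      rw [Real.sqrt_lt' one_pos]
      linarith
    linarith
  have hlarge : ∀ᶠ T : ℝ≥0 in atTop, R ≤ (1 - √((1 - Real.cos r) / 2)) * T :=
    ((NNReal.tendsto_coe_atTop.2 tendsto_id).const_mul_atTop hκ).eventually_ge_atTop R
  obtain ⟨T, hT1, hT2, hT0⟩ := ((hX.eventually_norm_sub_lt (F := F) hj).and
    (hlarge.and (eventually_gt_atTop 0))).exists
  have : CompactSpace Q := isCompact_iff_compactSpace.1 hQ
  -- Geodesic contraction at radius `T`: constant at time 0, uniformly close to `f` at time 1, and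
  -- outside the ball of radius `R` throughout.
  set H : Q × unitInterval → ℂ := fun p =>
    F (hX.toPath x₀ (hX.point (rayFrom x₀ z T) (rayFrom x₀ (h p.1) T) p.2)) with hHdef
  have hray : Continuous fun w : W => rayFrom x₀ (h w) T :=
    @Continuous.comp _ _ _ _ (visualTopology x₀) _ _ _ (continuous_rayFrom_apply x₀ T) hh
  have hH : Continuous H := by
    refine F.continuous.comp ((hX.continuous_toPath x₀).comp ?_)
    exact (hX.continuous_point (rayFrom x₀ z T)).comp
      (((hray.comp continuous_subtype_val).comp continuous_fst).prodMk continuous_snd)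
  have hH0 : ∀ p, H p ≠ 0 := fun p =>
    hR _ (hT2.trans (hX.le_dist_point x₀ z (h p.1) hr.le (hle _ p.1.2) hT0 p.2.2))
  have hstart : HasLog fun w : Q => H (w, 0) := by
    have hconst : ∀ w : Q, H (w, 0) = F (hX.toPath x₀ (rayFrom x₀ z T)) := fun w => by
      simp [hHdef, point_zero]
    refine ⟨fun _ => Complex.log (F (hX.toPath x₀ (rayFrom x₀ z T))), continuous_const,
      fun w => ?_⟩
    change _ = H (w, 0)
    rw [hconst w, Complex.exp_log]
    rw [← hconst w]
    exact hH0 _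
  refine (hasLog_iff_of_close (by fun_prop) (g := fun w : Q => H (w, 1)) (by fun_prop)
    fun w => ?_).2 (HasLog.of_homotopy hH hH0 hstart)
  have h1 : H (w, 1) = F (hX.toPath x₀ (rayFrom x₀ (h w) T)) := by
    simp [hHdef, point_one]
  rw [h1, hf, norm_sub_rev, ← hF']
  exact hT1 w

theorem pi_le_titsRadius [T2Space W] (hX : IsCATZero X)
    (hh : @Continuous _ _ _ (visualTopology x₀) h) {f : C(W, ℂ)} (hf : ∀ w, ‖f w‖ = 1)
    {Q : Set W} (hQ : IsCompact Q) (hlog : ¬ HasLog fun w : Q => f w) :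
    ENNReal.ofReal Real.pi ≤ titsRadius x₀ (h '' Q) := by
  refine le_sInf ?_
  rintro ε ⟨z, hz⟩
  by_contra! hlt
  refine hlog (hX.hasLog_of_boundaryAngle_le hh hf hQ z (r := ε.toReal) ENNReal.toReal_nonneg ?_ ?_)
  · rw [← ENNReal.toReal_ofReal Real.pi_pos.le]
    exact ENNReal.toReal_strict_mono ENNReal.ofReal_ne_top hlt
  · intro w hw
    have h1 := (boundaryAngle_le_titsDist x₀ z (h w)).trans_lt (hz (mem_image_of_mem h hw))
    exact (ENNReal.ofReal_le_iff_le_toReal hlt.ne_top).1 h1.le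

end Compactification

end IsCATZero

end TitsRadius

/-! ### The separated continuum and its Tits radius. -/

theorem mainTheorem3 {W : Type*} [TopologicalSpace W] [CompactSpace W] [T2Space W]
    [ConnectedSpace W] (m : ℕ) (hm : 2 ≤ m) (hW : IsThick W m)
    (A : Fin 8 → Set W) (hA : ∀ i, IsMinCut m (A i)) (hlin : LinearlyOrderedCuts A)
    (hwheel : ∀ i j, i ≠ j → ¬ ∃ F : Set W, IsWheel m F ∧ A i ⊆ F ∧ A j ⊆ F) :
    ∃ Q : Set W, IsSubcontinuum Q ∧ SetBetween (A 0) (A 7) Q ∧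
      (∃ (i : Fin 8) (Q₁ Q₂ : Set W),
        SeparatesInto (A i) Q Q₁ Q₂ ∧ 2 ≤ (Q₁ ∩ Q₂).encard) ∧
      ∀ (X : Type*) [MetricSpace X] [ProperSpace X], IsCATZero X →
        ∀ (x₀ : X) (h : W ≃ VisualBoundary X),
          @IsHomeomorph W (VisualBoundary X) _ (visualTopology x₀) h →
            ENNReal.ofReal Real.pi ≤ titsRadius x₀ (h '' Q) := by
  obtain ⟨i, Q, Q₁, Q₂, hbet, hsep, hcard⟩ := exists_separated_continuum hm hW A hA hlin hwheel
  have hnt : (Q₁ ∩ Q₂).Nontrivial := by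
    rw [← one_lt_encard_iff_nontrivial]
    exact lt_of_lt_of_le (by norm_num) hcard
  obtain ⟨-, h₁, h₂, rfl, M, N, hdec, hM, hN⟩ := id hsep
  have hQ : IsCompact (Q₁ ∪ Q₂) := h₁.1.union h₂.1
  refine ⟨_, ⟨hQ, h₁.2.union hnt.nonempty h₂.2⟩, hbet, ⟨i, Q₁, Q₂, hsep, hcard⟩, ?_⟩
  intro X _ _ hX x₀ h hh
  obtain ⟨f, hf, hlog⟩ := exists_circle_map (hA i).finite hdec h₁.2.isPreconnected
    h₂.2.isPreconnected hM hN hnt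
  exact hX.pi_le_titsRadius (@IsHomeomorph.continuous _ _ _ (visualTopology x₀) _ hh) hf hQ hlog
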